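/- **Setting.** Let $R$ be an integral domain with field of fractions $\mathbb F$. A cellular algebra over $R$ is a unital $R$-algebra $A$ with an $R$-linear algebra involution $*$, a finite poset $(\widehat A,\unrhd)$, finite nonempty index sets $I(\lambda)$ ($\lambda\in\widehat A$), and an $R$-basis $\{c^\lambda_{pq}:\lambda\in\widehat A,\ p,q\in I(\lambda)\}$ such that, writing $A^{\rhd\lambda}$ (resp. $A^{\unrhd\lambda}$) for the span of all $c^\mu_{pq}$ with $\mu\rhd\lambda$ (resp. $\mu\unrhd\lambda$): (a) for $a\in A$ and $q\in I(\lambda)$ there are $r(a;q,v)\in R$ with $c^\lambda_{pq}a\equiv\sum_v r(a;q,v)c^\lambda_{pv}$ mod $A^{\rhd\lambda}$ for all $p$; (b) $(c^\lambda_{pq})^*\equiv c^\lambda_{qp}$ mod $A^{\rhd\lambda}$. The cell module $\Delta(\lambda)$ is the right $A$-module that is free over $R$ on $\{c^\lambda_q\}_{q\in I(\lambda)}$ with $c^\lambda_q a=\sum_v r(a;q,v)c^\lambda_v$; $\Delta(\lambda)^*$ is the same $R$-module with left action $a\cdot x=xa^*$. Let $A_0\subseteq A_1\subseteq A_2\subseteq\cdots$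 be an increasing sequence of cellular algebras over $R$, with unital inclusions and consistent involutions; write $\widehat A_r$ for the poset and $\Delta_r(\lambda)$ for the cell modules of $A_r$, and put $A_r^{\mathbb F}=A_r\otimes_R\mathbb F$, $\Delta_r^{\mathbb F}(\lambda)=\Delta_r(\lambda)\otimes_R\mathbb F$. An *order preserving cell-filtration* of $\mathrm{Res}_{A_{r}}\Delta_{r+1}(\mu)$ is a filtration $0=M_0\subseteq M_1\subseteq\cdots\subseteq M_n=\Delta_{r+1}(\mu)$ by right $A_r$-submodules with $M_i/M_{i-1}\cong\Delta_r(\lambda^{(i)})$ and $\lambda^{(1)}\rhd\lambda^{(2)}\rhd\cdots\rhd\lambda^{(n)}$. In the *branching diagram* there is an edge $\lambda\to\mu$ ($\lambda\in\widehat A_r$, $\mu\in\widehat A_{r+1}$) iff $\Delta_r(\lambda)$ is one of the subquotients $M_i/M_{i-1}$ of such a filtration. Let $\mathrm{Std}_r(\lambda)$ be the set of directed paths $\mathsf t=(\mathsf t(0)\to\mathsf t(1)\to\cdots\to\mathsf t(r)=\lambda)$ with $\mathsf t(j)\in\widehat A_j$. The *dominance order* on paths is: $\mathsf s\unrhd\mathsf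 t$ iff $\mathsf s(j)\unrhd\mathsf t(j)$ for all $0\le j\le r$; and $\mathsf s\rhd\mathsf t$ iff $\mathsf s\unrhd\mathsf t$ and $\mathsf s\ne\mathsf t$. Fix, for all $r$ and $\lambda\in\widehat A_r$: a generator $\delta_r(\lambda)$ of the right $A_r$-module $\Delta_r(\lambda)$; an $A_r$-bimodule isomorphism $\alpha_\lambda:A_r^{\unrhd\lambda}/A_r^{\rhd\lambda}\to\Delta_r(\lambda)^*\otimes_R\Delta_r(\lambda)$; an element $m_\lambda\in A_r^{\unrhd\lambda}$ with $\alpha_\lambda(m_\lambda+A_r^{\rhd\lambda})=\delta_r(\lambda)^*\otimes\delta_r(\lambda)$; and, for $\mu\in\widehat A_{r+1}$, an order preserving cell-filtration $(M_i)$ of $\mathrm{Res}_{A_r}\Delta_{r+1}(\mu)$ with isomorphisms $M_i/M_{i-1}\cong\Delta_r(\lambda^{(i)})$, together with *branching factors* $d_{\lambda^{(i)}\to\mu}\in A_{r+1}$ such that $\delta_{r+1}(\mu)\,d_{\lambda^{(i)}\to\mu}\in M_i$ and its class in $M_i/M_{i-1}$ corresponds to $\delta_r(\lambda^{(i)})$.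 Assume that $(A_r)_{r\ge0}$ is a tower of diagram algebras, i.e. - (D1) $A_0=R$; - (D2) every $A_r$ is cyclic cellular, i.e. all its cell modules are cyclic; - (D3) $m_\lambda^*=m_\lambda$ for all $\lambda$; - (D4) every $A_r^{\mathbb F}$ is split semisimple; - (D5) every $\mathrm{Res}_{A_r}\Delta_{r+1}(\mu)$ has an order preserving cell-filtration; - (D6) for every edge $\lambda\to\mu$ with $\mu\in\widehat A_{r+1}$ there is $u_{\lambda\to\mu}\in A_{r+1}$ with $m_\mu d_{\lambda\to\mu}=(u_{\lambda\to\mu})^*m_\lambda$. For $\mathsf t\in\mathrm{Std}_r(\lambda)$ put $d_{\mathsf t}=d_{\mathsf t(r-1)\to\mathsf t(r)}\cdots d_{\mathsf t(0)\to\mathsf t(1)}$ and let $m^\lambda_{\mathsf t}=\delta_r(\lambda)\,d_{\mathsf t}\in\Delta_r(\lambda)\subseteq\Delta_r^{\mathbb F}(\lambda)$ (the *Murphy basis*; equivalently $m^\lambda_{\mathsf t}$ is the class $m_\lambda d_{\mathsf t}+A_r^{\rhd\lambda}$ when $(m_\lambda A_r+A_r^{\rhd\lambda})/A_r^{\rhd\lambda}$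 is identified with $\Delta_r(\lambda)$ via $m_\lambda a\mapsto\delta_r(\lambda)a$). Let $z_s^\mu$ be the minimal central idempotent of $A_s^{\mathbb F}$ acting as the identity on $\Delta_s^{\mathbb F}(\mu)$, let $F_{\mathsf t}=\prod_{s=1}^r z_s^{\mathsf t(s)}\in A_r^{\mathbb F}$ (the *Gelfand–Zeitlin idempotent*), and put $f^\lambda_{\mathsf t}=m^\lambda_{\mathsf t}F_{\mathsf t}\in\Delta_r^{\mathbb F}(\lambda)$. **Theorem (Dominance triangularity).** Fix $r\ge0$ and $\lambda\in\widehat A_r$. For every $\mathsf t\in\mathrm{Std}_r(\lambda)$ there exist coefficients $r_{\mathsf s},r'_{\mathsf s}\in\mathbb F$ such that $$m^\lambda_{\mathsf t}=f^\lambda_{\mathsf t}+\sum_{\substack{\mathsf s\in\mathrm{Std}_r(\lambda)\\ \mathsf s\rhd\mathsf t}}r_{\mathsf s}\,f^\lambda_{\mathsf s},\qquad f^\lambda_{\mathsf t}=m^\lambda_{\mathsf t}+\sum_{\substack{\mathsf s\in\mathrm{Std}_r(\lambda)\\ \mathsf s\rhd\mathsf t}}r'_{\mathsf s}\,m^\lambda_{\mathsf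 s}.$$ In particular, $\{f^\lambda_{\mathsf t}:\mathsf t\in\mathrm{Std}_r(\lambda)\}$ is a basis of $\Delta_r^{\mathbb F}(\lambda)$. -/

import Mathlib

open scoped TensorProduct

/-! ### Cellular algebras -/

/-- A cell datum for the `R`-algebra `A`, with finite poset `L` (where `μ ≥ ν` is the order
`μ ⊵ ν`) and finite index sets `I μ`: an `R`-linear algebra involution `inv` and an `R`-basis
`c^μ_{st}` satisfying the two cellular axioms. -/
structure CellDatum (R A : Type*) [CommRing R] [Ring A] [Algebra R A]
    (L : Type*) [PartialOrder L] (I : L → Type*) [∀ μ, Fintype (I μ)] where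
  inv : A →ₗ[R] A
  inv_inv : ∀ a, inv (inv a) = a
  inv_mul : ∀ a b, inv (a * b) = inv b * inv a
  basis : Module.Basis (Σ μ : L, I μ × I μ) R A
  basis_mul : ∀ (μ : L) (t : I μ) (a : A), ∃ r : I μ → R, ∀ s : I μ,
    basis ⟨μ, (s, t)⟩ * a - ∑ v, r v • basis ⟨μ, (s, v)⟩ ∈
      Submodule.span R {x | ∃ ν, ν > μ ∧ ∃ p q : I ν, x = basis ⟨ν, (p, q)⟩}
  inv_basis : ∀ (μ : L) (s t : I μ),
    inv (basis ⟨μ, (s, t)⟩) - basis ⟨μ, (t, s)⟩ ∈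
      Submodule.span R {x | ∃ ν, ν > μ ∧ ∃ p q : I ν, x = basis ⟨ν, (p, q)⟩}

namespace CellDatum

section

variable {R A : Type*} [CommRing R] [Ring A] [Algebra R A]
  {L : Type*} [PartialOrder L] {I : L → Type*} [∀ μ, Fintype (I μ)]
  (D : CellDatum R A L I)

/-- `A^{▷ μ}`. -/
def idealGT (μ : L) : Submodule R A :=
  Submodule.span R {x | ∃ ν, ν > μ ∧ ∃ p q : I ν, x = D.basis ⟨ν, (p, q)⟩}

/-- `A^{⊵ μ}`. -/
def idealGE (μ : L) : Submodule R A :=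
  Submodule.span R {x | ∃ ν, ν ≥ μ ∧ ∃ p q : I ν, x = D.basis ⟨ν, (p, q)⟩}

theorem idealGT_anti {μ ν : L} (h : μ ≤ ν) : D.idealGT ν ≤ D.idealGT μ := by
  apply Submodule.span_mono
  rintro x ⟨κ, hκ, p, q, rfl⟩
  exact ⟨κ, lt_of_le_of_lt h hκ, p, q, rfl⟩

theorem idealGT_le_idealGE (μ : L) : D.idealGT μ ≤ D.idealGE μ := by
  apply Submodule.span_mono
  rintro x ⟨κ, hκ, p, q, rfl⟩
  exact ⟨κ, hκ.le, p, q, rfl⟩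

theorem idealGE_le_idealGT {μ ν : L} (h : μ < ν) : D.idealGE ν ≤ D.idealGT μ := by
  apply Submodule.span_mono
  rintro x ⟨κ, hκ, p, q, rfl⟩
  exact ⟨κ, lt_of_lt_of_le h hκ, p, q, rfl⟩

theorem idealGE_anti {μ ν : L} (h : μ ≤ ν) : D.idealGE ν ≤ D.idealGE μ := by
  apply Submodule.span_mono
  rintro x ⟨κ, hκ, p, q, rfl⟩
  exact ⟨κ, le_trans h hκ, p, q, rfl⟩

theorem basis_mem_idealGE (μ : L) (s t : I μ) : D.basis ⟨μ, (s, t)⟩ ∈ D.idealGE μ :=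
  Submodule.subset_span ⟨μ, le_rfl, s, t, rfl⟩

theorem basis_mul_mem_idealGE (μ : L) (s t : I μ) (a : A) :
    D.basis ⟨μ, (s, t)⟩ * a ∈ D.idealGE μ := by
  obtain ⟨r, hr⟩ := D.basis_mul μ t a
  have h1 := D.idealGT_le_idealGE μ (hr s)
  have h2 : ∑ v, r v • D.basis ⟨μ, (s, v)⟩ ∈ D.idealGE μ :=
    Submodule.sum_mem _ fun v _ => Submodule.smul_mem _ _ (D.basis_mem_idealGE μ s v)
  simpa using Submodule.add_mem _ h1 h2

theorem idealGE_mul_right (μ : L) {x : A} (hx : x ∈ D.idealGE μ) (a : A) :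
    x * a ∈ D.idealGE μ := by
  induction hx using Submodule.span_induction with
  | mem x h =>
    obtain ⟨ν, hν, p, q, rfl⟩ := h
    exact D.idealGE_anti hν (D.basis_mul_mem_idealGE ν p q a)
  | zero => simp
  | add x y _ _ hx hy => rw [add_mul]; exact Submodule.add_mem _ hx hy
  | smul c x _ hx => rw [smul_mul_assoc]; exact Submodule.smul_mem _ _ hx

theorem idealGT_mul_right (μ : L) {x : A} (hx : x ∈ D.idealGT μ) (a : A) :
    x * a ∈ D.idealGT μ := by
  induction hx using Submodule.span_induction with
  | mem x h =>
    obtain ⟨ν, hν, p, q, rfl⟩ := h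
    exact D.idealGE_le_idealGT hν (D.basis_mul_mem_idealGE ν p q a)
  | zero => simp
  | add x y _ _ hx hy => rw [add_mul]; exact Submodule.add_mem _ hx hy
  | smul c x _ hx => rw [smul_mul_assoc]; exact Submodule.smul_mem _ _ hx

theorem inv_mem_idealGE (μ : L) {x : A} (hx : x ∈ D.idealGE μ) : D.inv x ∈ D.idealGE μ := by
  induction hx using Submodule.span_induction with
  | mem x h =>
    obtain ⟨ν, hν, p, q, rfl⟩ := h
    apply D.idealGE_anti hν
    have h1 := D.idealGT_le_idealGE ν (D.inv_basis ν p q)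
    simpa using Submodule.add_mem _ h1 (D.basis_mem_idealGE ν q p)
  | zero => simp
  | add x y _ _ hx hy => rw [map_add]; exact Submodule.add_mem _ hx hy
  | smul c x _ hx => rw [map_smul]; exact Submodule.smul_mem _ _ hx

theorem idealGE_mul_left (μ : L) {x : A} (hx : x ∈ D.idealGE μ) (a : A) :
    a * x ∈ D.idealGE μ := by
  have h := D.inv_mem_idealGE μ (D.idealGE_mul_right μ (D.inv_mem_idealGE μ hx) (D.inv a))
  rwa [D.inv_mul, D.inv_inv, D.inv_inv] at h

theorem mul_mul_mem_idealGE (μ : L) (a b : A) (x : D.idealGE μ) :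
    a * (x : A) * b ∈ D.idealGE μ :=
  D.idealGE_mul_right μ (D.idealGE_mul_left μ x.2 a) b

/-- The structure constant `r(a; t, v)`, read off as the coefficient of `c^μ_{tv}` in
`c^μ_{tt} a`. -/
noncomputable def coeff {μ : L} (a : A) (t v : I μ) : R :=
  D.basis.repr (D.basis ⟨μ, (t, t)⟩ * a) ⟨μ, (t, v)⟩

theorem repr_idealGT (μ : L) {x : A} (hx : x ∈ D.idealGT μ) (s v : I μ) :
    D.basis.repr x ⟨μ, (s, v)⟩ = 0 := by
  induction hx using Submodule.span_induction with
  | mem x h =>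
    obtain ⟨ν, hν, p, q, rfl⟩ := h
    rw [Module.Basis.repr_self, Finsupp.single_apply_eq_zero]
    intro h
    exact absurd (congrArg Sigma.fst h) (ne_of_lt hν)
  | zero => simp
  | add x y _ _ hx hy => simp [hx, hy]
  | smul c x _ hx => simp [hx]

theorem repr_sum_basis {μ : L} (r : I μ → R) (s v : I μ) :
    D.basis.repr (∑ w, r w • D.basis ⟨μ, (s, w)⟩) ⟨μ, (s, v)⟩ = r v := by
  classical
  simp only [map_sum, map_smul, Module.Basis.repr_self, Finsupp.coe_finsetSum, Finset.sum_apply,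
    Finsupp.smul_apply, smul_eq_mul]
  rw [Finset.sum_eq_single v]
  · simp
  · intro b _ hb
    rw [Finsupp.single_eq_of_ne, mul_zero]
    intro h
    simp at h
    exact hb h.symm
  · simp

/-- The numbers `coeff a t v` are the (unique) ones that occur in the first cellular axiom. -/
theorem basis_mul_sub_mem {μ : L} (s t : I μ) (a : A) :
    D.basis ⟨μ, (s, t)⟩ * a - ∑ v, D.coeff a t v • D.basis ⟨μ, (s, v)⟩ ∈ D.idealGT μ := by
  obtain ⟨r, hr⟩ := D.basis_mul μ t a
  have key : ∀ v, D.coeff a t v = r v := by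
    intro v
    have h := D.repr_idealGT μ (hr t) t v
    rw [map_sub, Finsupp.sub_apply, D.repr_sum_basis] at h
    exact sub_eq_zero.mp h
  simp only [key]
  exact hr s

theorem coeff_one {μ : L} [DecidableEq (I μ)] (t v : I μ) :
    D.coeff 1 t v = if t = v then 1 else 0 := by
  classical
  unfold coeff
  rw [mul_one, Module.Basis.repr_self, Finsupp.single_apply]
  by_cases h : t = v <;> simp [h]

theorem coeff_mul {μ : L} (a b : A) (t v : I μ) :
    D.coeff (a * b) t v = ∑ w, D.coeff a t w * D.coeff b w v := by
  have h1 := D.repr_idealGT μ (D.idealGT_mul_right μ (D.basis_mul_sub_mem t t a) b) t v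
  rw [sub_mul, map_sub, Finsupp.sub_apply, mul_assoc, sub_eq_zero] at h1
  have h2 : ∀ w, D.basis.repr (D.basis ⟨μ, (t, w)⟩ * b) ⟨μ, (t, v)⟩ = D.coeff b w v := by
    intro w
    have h := D.repr_idealGT μ (D.basis_mul_sub_mem t w b) t v
    rw [map_sub, Finsupp.sub_apply, D.repr_sum_basis] at h
    exact sub_eq_zero.mp h
  unfold coeff at h1 ⊢
  rw [h1]
  simp only [Finset.sum_mul, map_sum, smul_mul_assoc, map_smul, Finsupp.coe_finsetSum,
    Finset.sum_apply, Finsupp.smul_apply, smul_eq_mul, h2]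
  rfl

/-- The cell module `Δ(μ)`: the free `R`-module on `I μ`, with the right action of `A` given
by `act` below. -/
abbrev Cell (_D : CellDatum R A L I) (μ : L) : Type _ := I μ → R

/-- The right action of `A` on the cell module: `act μ a x` is `x · a`, so that
`c_t · a = ∑ v, r(a; t, v) c_v`. -/
noncomputable def act (μ : L) : A →ₗ[R] Module.End R (D.Cell μ) :=
  LinearMap.mk₂ R (fun a x v => ∑ t, x t * D.coeff a t v)
    (by
      intro a b x; funext v
      simp [coeff, mul_add, Finset.sum_add_distrib])
    (by
      intro c a x; funext v
      simp [coeff, Finset.mul_sum, mul_left_comm])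
    (by
      intro a x y; funext v
      simp [add_mul, Finset.sum_add_distrib])
    (by
      intro c a x; funext v
      simp [Finset.mul_sum, mul_assoc])

theorem act_apply (μ : L) (a : A) (x : D.Cell μ) (v : I μ) :
    D.act μ a x v = ∑ t, x t * D.coeff a t v := rfl

theorem act_one (μ : L) (x : D.Cell μ) : D.act μ 1 x = x := by
  classical
  funext v
  simp [act_apply, coeff_one]

/-- `x · (a b) = (x · a) · b`. -/
theorem act_mul (μ : L) (a b : A) (x : D.Cell μ) :
    D.act μ (a * b) x = D.act μ b (D.act μ a x) := by
  funext v
  simp only [act_apply, coeff_mul, Finset.mul_sum, Finset.sum_mul]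
  rw [Finset.sum_comm]
  simp only [mul_assoc]

/-- The cell module is generated by `x` as a right `A`-module. -/
def IsCellGenerator (μ : L) (x : D.Cell μ) : Prop :=
  ∀ y : D.Cell μ, ∃ a : A, D.act μ a x = y

/-- The right action of `A^F = F ⊗ A` on `Δ^F(μ) = F ⊗ Δ(μ)`. -/
noncomputable def actF (F : Type*) [Field F] [Algebra R F] (μ : L) :
    F ⊗[R] A →ₗ[F] Module.End F (F ⊗[R] D.Cell μ) :=
  LinearMap.liftBaseChange F
    ((Module.End.baseChangeHom R F (D.Cell μ)).toLinearMap ∘ₗ D.act μ)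

theorem actF_tmul (F : Type*) [Field F] [Algebra R F] (μ : L) (p q : F) (a : A)
    (x : D.Cell μ) : D.actF F μ (p ⊗ₜ a) (q ⊗ₜ x) = (p * q) ⊗ₜ D.act μ a x := by
  have h : D.actF F μ (p ⊗ₜ a) = p • (D.act μ a).baseChange F := by
    simp only [actF, LinearMap.liftBaseChange_tmul]
    rfl
  rw [h, LinearMap.smul_apply, LinearMap.baseChange_tmul, TensorProduct.smul_tmul', smul_eq_mul]

end

end CellDatum

/-- Minimal central idempotents of a ring. -/
def IsMinimalCentralIdempotent {B : Type*} [Ring B] (z : B) : Prop :=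
  z ∈ Set.center B ∧ z * z = z ∧ z ≠ 0 ∧
    ∀ e ∈ Set.center B, e * e = e → e * z = e → e = 0 ∨ e = z

/-- A finite-dimensional split semisimple algebra over a field: a finite product of full matrix
algebras over that field. -/
def IsSplitSemisimple (F B : Type*) [Field F] [Ring B] [Algebra F B] : Prop :=
  ∃ (n : ℕ) (d : Fin n → ℕ), (∀ i, 0 < d i) ∧
    Nonempty (B ≃ₐ[F] ((i : Fin n) → Matrix (Fin (d i)) (Fin (d i)) F))

/-! ### Towers of cellular algebras -/

/-- An increasing sequence of cellular algebras `A 0 ⊆ A 1 ⊆ …`, with unital inclusions and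
consistent involutions. -/
structure CellularTower (R : Type*) [CommRing R] (A : ℕ → Type*) [∀ r, Ring (A r)]
    [∀ r, Algebra R (A r)] (L : ℕ → Type*) [∀ r, PartialOrder (L r)]
    (I : ∀ r, L r → Type*) [∀ r μ, Fintype (I r μ)] where
  datum : ∀ r, CellDatum R (A r) (L r) (I r)
  incl : ∀ r, A r →ₐ[R] A (r + 1)
  incl_injective : ∀ r, Function.Injective (incl r)
  incl_inv : ∀ r a, incl r ((datum r).inv a) = (datum (r + 1)).inv (incl r a)

namespace CellularTower

section

variable {R : Type*} [CommRing R] {A : ℕ → Type*} [∀ r, Ring (A r)]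
  [∀ r, Algebra R (A r)] {L : ℕ → Type*} [∀ r, PartialOrder (L r)]
  {I : ∀ r, L r → Type*} [∀ r μ, Fintype (I r μ)] (T : CellularTower R A L I)

/-- The cell module `Δ_r(μ)`. -/
abbrev Cell (r : ℕ) (μ : L r) : Type _ := (T.datum r).Cell μ

/-- An order preserving cell-filtration of the restriction to `A r` of the cell module
`Δ_{r+1}(μ)`:
`0 = M 0 ⊆ M 1 ⊆ ⋯ ⊆ M len = Δ_{r+1}(μ)`, with `M (i+1) / M i ≅ Δ_r(label i)` as right
`A r`-modules, and `label 0 ▷ label 1 ▷ ⋯`. -/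
structure CellFiltration (r : ℕ) (μ : L (r + 1)) where
  len : ℕ
  M : Fin (len + 1) → Submodule R (T.Cell (r + 1) μ)
  M_zero : M 0 = ⊥
  M_last : M (Fin.last len) = ⊤
  M_le : ∀ i : Fin len, M i.castSucc ≤ M i.succ
  stable : ∀ i (a : A r), ∀ x ∈ M i, (T.datum (r + 1)).act μ (T.incl r a) x ∈ M i
  label : Fin len → L r
  label_strictAnti : StrictAnti label
  iso : ∀ i : Fin len,
    (↥(M i.succ) ⧸ (M i.castSucc).submoduleOf (M i.succ)) ≃ₗ[R] T.Cell r (label i)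
  iso_act : ∀ (i : Fin len) (a : A r) (x : M i.succ),
    iso i (Submodule.Quotient.mk
        ⟨(T.datum (r + 1)).act μ (T.incl r a) x, stable i.succ a x x.2⟩) =
      (T.datum r).act (label i) a (iso i (Submodule.Quotient.mk x))

/-- The edges `ν → μ` of the branching diagram. -/
def Edge (r : ℕ) (ν : L r) (μ : L (r + 1)) : Prop :=
  ∃ (𝓜 : T.CellFiltration r μ) (i : Fin 𝓜.len), 𝓜.label i = ν

/-- `Std_r(μ)`: directed paths on the branching diagram from level `0` to `μ` on level `r`. -/
@[ext]
structure Std (r : ℕ) (μ : L r) where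
  vertex : ∀ j, j ≤ r → L j
  edge : ∀ j (h : j + 1 ≤ r),
    T.Edge j (vertex j ((Nat.le_succ j).trans h)) (vertex (j + 1) h)
  vertex_last : vertex r le_rfl = μ

instance (r : ℕ) (μ : L r) [∀ j, Finite (L j)] : Finite (T.Std r μ) := by
  apply Finite.of_injective
    (fun (t : T.Std r μ) (j : Fin (r + 1)) => t.vertex j (Nat.lt_succ_iff.mp j.2))
  intro s t h
  ext j hj
  exact congrFun h ⟨j, Nat.lt_succ_iff.mpr hj⟩

noncomputable instance (r : ℕ) (μ : L r) [∀ j, Finite (L j)] : Fintype (T.Std r μ) :=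
  Fintype.ofFinite _

variable {T}

/-- The truncation of a path of length `r + 1` to its first `r` steps. -/
def Std.trunc {r : ℕ} {μ : L (r + 1)} (t : T.Std (r + 1) μ) :
    T.Std r (t.vertex r (Nat.le_succ r)) where
  vertex j hj := t.vertex j (hj.trans (Nat.le_succ r))
  edge j h := t.edge j (h.trans (Nat.le_succ r))
  vertex_last := rfl

/-- The dominance order `s ⊵ t` on paths. -/
def Std.Dominates {r : ℕ} {μ : L r} (s t : T.Std r μ) : Prop :=
  ∀ j (hj : j ≤ r), s.vertex j hj ≥ t.vertex j hj

/-- The strict dominance order `s ▷ t` on paths. -/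
def Std.StrictlyDominates {r : ℕ} {μ : L r} (s t : T.Std r μ) : Prop :=
  s ≠ t ∧ s.Dominates t

noncomputable instance {r : ℕ} {μ : L r} (s t : T.Std r μ) : Decidable (s.StrictlyDominates t) :=
  Classical.dec _

variable (T)

/-- The inclusion of `A_r^F = F ⊗ A_r` in `A_{r+1}^F`. -/
noncomputable def inclF (F : Type*) [Field F] [Algebra R F] (r : ℕ) :
    F ⊗[R] A r →ₐ[F] F ⊗[R] A (r + 1) :=
  Algebra.TensorProduct.map (AlgHom.id F F) (T.incl r)

/-- The minimal central idempotent of `A_r^F` belonging to `μ`, that is, the one that acts as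
the identity on `Δ_r^F(μ)`. -/
noncomputable def centralIdempotent (F : Type*) [Field F] [Algebra R F] (r : ℕ) (μ : L r) :
    F ⊗[R] A r :=
  Classical.epsilon fun z => IsMinimalCentralIdempotent z ∧
    ∀ x, (T.datum r).actF F μ z x = x

/-- The Gelfand–Zeitlin idempotent `F_t`, the product over `1 ≤ s ≤ r` of the minimal central
idempotents of `A_s^F` belonging to `t(s)`. -/
noncomputable def gzIdempotent (F : Type*) [Field F] [Algebra R F] :
    ∀ {r : ℕ} {μ : L r}, T.Std r μ → F ⊗[R] A r
  | 0, _, _ => 1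
  | r + 1, _, t => T.inclF F r (gzIdempotent F t.trunc) *
      T.centralIdempotent F (r + 1) (t.vertex (r + 1) le_rfl)

/-- The choices from which the Murphy bases are built: for every `μ` on level `r`,
* a generator `gen r μ` (written `δ_r(μ)`) of the cell module `Δ_r(μ)`;
* an isomorphism `alpha r μ : A^{⊵ μ} / A^{▷ μ} ≅ Δ_r(μ)^* ⊗ Δ_r(μ)` of bimodules, where `Δ_r(μ)^*`
  is `Δ_r(μ)` with the left action `a · x = x · a^*`;
* an element `m r μ` (written `m_μ`) of `A^{⊵ μ}` that is a lift of `δ_r(μ)^* ⊗ δ_r(μ)`;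
* an order preserving cell-filtration of the restriction of each `Δ_{r+1}(μ)` to `A r`, and
  branching factors `d r ν μ` (written `d_{ν → μ}`) in `A (r + 1)` that represent it: for the
  `i`-th subquotient `M (i+1) / M i ≅ Δ_r(ν)`, the vector `δ_{r+1}(μ) d_{ν → μ}` lies in `M (i+1)`
  and its class corresponds to the generator `δ_r(ν)`.
The values of `d r ν μ` when there is no edge `ν → μ` are irrelevant. -/
structure MurphyData where
  gen : ∀ r (μ : L r), T.Cell r μ
  gen_spec : ∀ r μ, (T.datum r).IsCellGenerator μ (gen r μ)
  alpha : ∀ r (μ : L r),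
    (↥((T.datum r).idealGE μ) ⧸ ((T.datum r).idealGT μ).submoduleOf ((T.datum r).idealGE μ))
      ≃ₗ[R] T.Cell r μ ⊗[R] T.Cell r μ
  alpha_bimodule : ∀ r (μ : L r) (a b : A r) (x : (T.datum r).idealGE μ),
    alpha r μ (Submodule.Quotient.mk
        ⟨a * (x : A r) * b, (T.datum r).mul_mul_mem_idealGE μ a b x⟩) =
      TensorProduct.map ((T.datum r).act μ ((T.datum r).inv a)) ((T.datum r).act μ b)
        (alpha r μ (Submodule.Quotient.mk x))
  m : ∀ r (μ : L r), (T.datum r).idealGE μ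
  alpha_m : ∀ r μ, alpha r μ (Submodule.Quotient.mk (m r μ)) = gen r μ ⊗ₜ gen r μ
  filtration : ∀ r (μ : L (r + 1)), T.CellFiltration r μ
  d : ∀ r, L r → L (r + 1) → A (r + 1)
  d_spec : ∀ r (μ : L (r + 1)) (i : Fin (filtration r μ).len),
    ∃ h : (T.datum (r + 1)).act μ (d r ((filtration r μ).label i) μ) (gen (r + 1) μ) ∈
        (filtration r μ).M i.succ,
      (filtration r μ).iso i (Submodule.Quotient.mk ⟨_, h⟩) = gen r ((filtration r μ).label i)

namespace MurphyData

variable {T} (C : T.MurphyData)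

/-- `d_t = d_{t(r-1) → t(r)} ⋯ d_{t(0) → t(1)}`. -/
def pathFactor : ∀ {r : ℕ} {μ : L r}, T.Std r μ → A r
  | 0, _, _ => 1
  | r + 1, _, t => C.d r (t.vertex r (Nat.le_succ r)) (t.vertex (r + 1) le_rfl) *
      T.incl r (pathFactor t.trunc)

/-- The vector `m_t` of the cell module `Δ_r(μ)`. It is the class of `m_μ d_t` modulo `A^{▷ μ}`,
when `(m_μ A + A^{▷ μ}) / A^{▷ μ}` is identified with `Δ_r(μ)` by `m_μ a ↦ δ_r(μ) a`, see
`alpha_m_mul` below. -/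
noncomputable def murphy {r : ℕ} {μ : L r} (t : T.Std r μ) : T.Cell r μ :=
  (T.datum r).act μ (C.pathFactor t) (C.gen r μ)

theorem alpha_m_mul (r : ℕ) (μ : L r) (a : A r) :
    C.alpha r μ (Submodule.Quotient.mk
        ⟨(C.m r μ : A r) * a, (T.datum r).idealGE_mul_right μ (C.m r μ).2 a⟩) =
      C.gen r μ ⊗ₜ (T.datum r).act μ a (C.gen r μ) := by
  have h := C.alpha_bimodule r μ 1 a (C.m r μ)
  have h1 : (T.datum r).inv 1 = 1 := by
    have h2 := (T.datum r).inv_mul 1 ((T.datum r).inv 1)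
    rw [one_mul, (T.datum r).inv_inv, one_mul] at h2
    exact h2.symm
  rw [C.alpha_m, TensorProduct.map_tmul, h1, (T.datum r).act_one] at h
  rw [← h]
  simp

/-- `m_t`, regarded as an element of `Δ_r^F(μ)`. -/
noncomputable def murphyF (F : Type*) [Field F] [Algebra R F] {r : ℕ} {μ : L r}
    (t : T.Std r μ) : F ⊗[R] T.Cell r μ :=
  1 ⊗ₜ C.murphy t

/-- The seminormal vector `f_t = m_t F_t`. -/
noncomputable def seminormal (F : Type*) [Field F] [Algebra R F] {r : ℕ} {μ : L r}
    (t : T.Std r μ) : F ⊗[R] T.Cell r μ :=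
  (T.datum r).actF F μ (T.gzIdempotent F t) (C.murphyF F t)

/-- The axioms of a tower of diagram algebras, with the given choices. -/
structure IsDiagramTower (F : Type*) [Field F] [Algebra R F] : Prop where
  /-- `A_0 = R`. -/
  base : Function.Bijective (algebraMap R (A 0))
  /-- The algebras `A_r` are cyclic cellular. -/
  cyclic : ∀ r (μ : L r), ∃ x, (T.datum r).IsCellGenerator μ x
  /-- `m_μ` is fixed by the involution. -/
  m_symm : ∀ r (μ : L r), (T.datum r).inv (C.m r μ) = C.m r μ
  /-- `A_r^F` is split semisimple. -/
  split_semisimple : ∀ r, IsSplitSemisimple F (F ⊗[R] A r)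
  /-- The tower is restriction-coherent. -/
  restriction_coherent : ∀ r (μ : L (r + 1)), Nonempty (T.CellFiltration r μ)
  /-- There are `u`-branching factors, compatible with the branching factors `d_{ν → μ}`. -/
  compatible : ∀ r (ν : L r) (μ : L (r + 1)), T.Edge r ν μ →
    ∃ u : A (r + 1), (C.m (r + 1) μ : A (r + 1)) * C.d r ν μ =
      (T.datum (r + 1)).inv u * T.incl r (C.m r ν)

end MurphyData

end

end CellularTower

/-!
Put `V = F ⊗ Δ_r(μ)`. The proof rests on three properties of the Gelfand–Zeitlin idempotents `F_s`,
where `s` runs through the paths to `μ`.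

* They are pairwise orthogonal and their sum acts as the identity on `V`
  (`gzIdempotent_mul_of_ne`, `sum_actF_gzIdempotent`).
* The image of `F_s` on `V` is the line spanned by `f_s ≠ 0`
  (`seminormal_ne_zero_and_actF_gzIdempotent_mem`).
* `m_t F_s = 0` unless `s ⊵ t` (`actF_gzIdempotent_murphyF_eq_zero`).

Hence `m_t = ∑ s, m_t F_s` only involves `f_t`, with coefficient `1`, and vectors `f_s` with `s ▷ t`;
the `f_s` form a basis, and the unitriangular system can be inverted.

The block idempotents are controlled as follows. A semisimple `A^F` acts faithfully on the sum of
its cell modules, because the kernel is generated by an idempotent that acts nilpotently along the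
cell filtration of `A^F`. Comparing dimensions, `A^F` is the product of the full endomorphism rings
of its cell modules (`exists_actF_eq`). So the block idempotent of `μ` is the identity on `Δ^F(μ)`
and zero on the other cell modules, and it annihilates `A^{⊵ ν}` unless `μ ⊵ ν`.

Since `F` is flat over `R`, a cell-filtration of `Δ_{r+1}(μ)` remains one over `F`. Its labels are
distinct, so the block of an edge `ν → μ` is a copy of `Δ_r^F(ν)` in which the generator of
`Δ_r^F(ν)` is the component of `δ_{r+1}(μ) d_{ν → μ}`, and the other blocks vanish
(`exists_branching_embedding`). The first two properties follow by induction on `r`.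

For the third, compatibility of the branching factors puts `m_μ d_t` into the left ideal of `A_r`
generated by `A_j^{⊵ t(j)}`, for every `j`. This ideal is annihilated by the block idempotent of
`s(j)` unless `s(j) ⊵ t(j)`, see `tmul_m_mul_gzIdempotent_eq_zero`. The isomorphism `α_μ` carries
the conclusion from `m_μ d_t F_s` to the vector `m_t F_s` of the cell module.
-/

/-! ### Cellular algebras over the field of fractions -/

namespace CellDatum

section

variable {R A : Type*} [CommRing R] [Ring A] [Algebra R A]
  {L : Type*} [PartialOrder L] {I : L → Type*} [∀ μ, Fintype (I μ)]
  (D : CellDatum R A L I) (F : Type*) [Field F] [Algebra R F]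

theorem actF_one (μ : L) (x : F ⊗[R] D.Cell μ) : D.actF F μ 1 x = x := by
  induction x using TensorProduct.induction_on with
  | zero => simp
  | tmul q x => rw [Algebra.TensorProduct.one_def, actF_tmul, one_mul, act_one]
  | add x y hx hy => rw [map_add, hx, hy]

/-- `x · (a b) = (x · a) · b` over the field `F`. -/
theorem actF_mul (μ : L) (a b : F ⊗[R] A) (x : F ⊗[R] D.Cell μ) :
    D.actF F μ (a * b) x = D.actF F μ b (D.actF F μ a x) := by
  induction x using TensorProduct.induction_on with
  | zero => simp
  | add x y hx hy => simp only [map_add, hx, hy]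
  | tmul q x =>
    induction a using TensorProduct.induction_on with
    | zero => simp
    | add a a' ha ha' => simp only [add_mul, map_add, LinearMap.add_apply, ha, ha']
    | tmul p a =>
      induction b using TensorProduct.induction_on with
      | zero => simp
      | add b b' hb hb' => simp only [mul_add, map_add, LinearMap.add_apply, hb, hb']
      | tmul p' b =>
        rw [Algebra.TensorProduct.tmul_mul_tmul, actF_tmul, actF_tmul, actF_tmul, act_mul]
        congr 1
        ring

/-- The row `s` of the layer `μ`, as the linear map `Δ(μ) → A` that sends `c_v` to `c^μ_{sv}`. -/
noncomputable def cellRow (μ : L) (s : I μ) : D.Cell μ →ₗ[R] A :=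
  Fintype.linearCombination R fun v => D.basis ⟨μ, (s, v)⟩

/-- The first cellular axiom over `F`: modulo `A^{▷ μ}`, right multiplication of `c^μ_{st}` by `a`
is the action of `a` on `c_t`. -/
theorem basis_mul_sub_mem_baseChange {μ : L} [DecidableEq (I μ)]
    (s t : I μ) (a : F ⊗[R] A) :
    ((1 : F) ⊗ₜ[R] D.basis ⟨μ, (s, t)⟩) * a -
      (D.cellRow μ s).baseChange F (D.actF F μ a (1 ⊗ₜ Pi.single t 1)) ∈
      (D.idealGT μ).baseChange F := by
  induction a using TensorProduct.induction_on with
  | zero => simp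
  | add a b ha hb =>
    rw [mul_add, map_add, LinearMap.add_apply, map_add, add_sub_add_comm]
    exact Submodule.add_mem _ ha hb
  | tmul p a =>
    rw [Algebra.TensorProduct.tmul_mul_tmul, actF_tmul, one_mul, mul_one,
      LinearMap.baseChange_tmul, ← TensorProduct.tmul_sub]
    refine Submodule.tmul_mem_baseChange_of_mem _ ?_
    convert D.basis_mul_sub_mem s t a using 2
    rw [cellRow, Fintype.linearCombination_apply]
    refine Finset.sum_congr rfl fun v _ => ?_
    rw [act_apply, Finset.sum_eq_single t] <;> simp +contextual

/-- Right multiplication by an element that kills all cell modules moves each layer of the cell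
filtration into a higher one, so an idempotent of this kind is zero. -/
theorem idempotent_eq_zero_of_actF_eq_zero [Finite L] {e : F ⊗[R] A} (he : e * e = e)
    (h : ∀ μ, D.actF F μ e = 0) : e = 0 := by
  classical
  have key : ∀ μ (s t : I μ), ((1 : F) ⊗ₜ[R] D.basis ⟨μ, (s, t)⟩) * e = 0 := by
    intro μ
    induction μ using WellFoundedGT.induction with
    | ind μ ih =>
      intro s t
      have h1 := D.basis_mul_sub_mem_baseChange F s t e
      rw [h, LinearMap.zero_apply, map_zero, sub_zero] at h1
      have h2 : ∀ y ∈ (D.idealGT μ).baseChange F, y * e = 0 := by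
        intro y hy
        rw [idealGT, Submodule.baseChange_span] at hy
        induction hy using Submodule.span_induction with
        | mem x hx =>
          obtain ⟨_, ⟨ν, hν, p, q, rfl⟩, rfl⟩ := hx
          exact ih ν hν p q
        | zero => simp
        | add x y _ _ hx hy => rw [add_mul, hx, hy, add_zero]
        | smul c x _ hx => rw [smul_mul_assoc, hx, smul_zero]
      have h3 := h2 _ h1
      rwa [mul_assoc, he] at h3
  have h1 : LinearMap.mulRight F e = 0 := by
    apply (D.basis.baseChange F).ext
    rintro ⟨μ, s, t⟩
    simpa using key μ s t
  simpa using LinearMap.congr_fun h1 1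

/-- If `A^F` is semisimple, the direct sum of the cell modules is faithful. -/
theorem eq_zero_of_actF_eq_zero [Finite L] [IsSemisimpleRing (F ⊗[R] A)] {a : F ⊗[R] A}
    (h : ∀ μ, D.actF F μ a = 0) : a = 0 := by
  let K : Ideal (F ⊗[R] A) :=
    { carrier := {a | ∀ μ, D.actF F μ a = 0}
      zero_mem' := by simp
      add_mem' := by
        intro a b ha hb μ
        rw [map_add, ha μ, hb μ, add_zero]
      smul_mem' := by
        intro c x hx μ
        ext1
        ext y
        simp [actF_mul, hx μ] }
  obtain ⟨e, he, hK⟩ := IsSemisimpleRing.ideal_eq_span_idempotent K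
  have heK : e ∈ K := hK ▸ Ideal.mem_span_singleton_self e
  have ha : a ∈ K := h
  rw [D.idempotent_eq_zero_of_actF_eq_zero F he heK] at hK
  simpa [hK] using ha

/-- If `A^F` is semisimple, it acts on its cell modules as the product of their full endomorphism
rings: the action is faithful, and both sides have dimension `∑ μ, |I μ| ^ 2`. -/
theorem exists_actF_eq [Nontrivial R] [Finite L] [IsSemisimpleRing (F ⊗[R] A)]
    (φ : ∀ μ, Module.End F (F ⊗[R] D.Cell μ)) : ∃ a, ∀ μ, D.actF F μ a = φ μ := by
  classical
  have := Fintype.ofFinite L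
  have : Module.Finite R A := Module.Finite.of_basis D.basis
  have : Module.Free R A := Module.Free.of_basis D.basis
  let Φ : F ⊗[R] A →ₗ[F] ∀ μ, Module.End F (F ⊗[R] D.Cell μ) := LinearMap.pi (D.actF F)
  have hinj : Function.Injective Φ := by
    rw [injective_iff_map_eq_zero]
    intro a ha
    exact D.eq_zero_of_actF_eq_zero F fun μ => congrFun ha μ
  have hdim : Module.finrank F (F ⊗[R] A) =
      Module.finrank F (∀ μ, Module.End F (F ⊗[R] D.Cell μ)) := by
    rw [Module.finrank_baseChange, Module.finrank_eq_card_basis D.basis, Module.finrank_pi_fintype]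
    simp [Module.finrank_linearMap]
  obtain ⟨a, ha⟩ := (LinearMap.injective_iff_surjective_of_finrank_eq_finrank hdim).mp hinj φ
  exact ⟨a, fun μ => congrFun ha μ⟩

theorem ext_actF [Finite L] [IsSemisimpleRing (F ⊗[R] A)] {a b : F ⊗[R] A}
    (h : ∀ μ x, D.actF F μ a x = D.actF F μ b x) : a = b := by
  rw [← sub_eq_zero]
  refine D.eq_zero_of_actF_eq_zero F fun μ => ?_
  rw [map_sub, sub_eq_zero]
  exact LinearMap.ext (h μ)

theorem nontrivial_cellF [Nontrivial R] (μ : L) [Nonempty (I μ)] :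
    Nontrivial (F ⊗[R] D.Cell μ) := by
  apply Module.nontrivial_of_finrank_pos (R := F)
  rw [Module.finrank_baseChange, Module.finrank_fintype_fun_eq_card]
  exact Fintype.card_pos

/-- The block idempotents of `A^F`: the projection to the factor `End Δ^F(μ)`. It is a minimal
central idempotent because the centre of this factor consists of scalars. -/
theorem exists_blockIdempotent [Nontrivial R] [Finite L] [IsSemisimpleRing (F ⊗[R] A)] (μ : L)
    [Nonempty (I μ)] :
    ∃ z : F ⊗[R] A, IsMinimalCentralIdempotent z ∧ (∀ x, D.actF F μ z x = x) ∧
      ∀ ν, ν ≠ μ → ∀ x, D.actF F ν z x = 0 := by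
  classical
  have := D.nontrivial_cellF F μ
  obtain ⟨z, hz⟩ := D.exists_actF_eq F (Pi.single μ 1)
  have h1 : ∀ x, D.actF F μ z x = x := fun x => by simp [hz]
  have h2 : ∀ ν, ν ≠ μ → ∀ x, D.actF F ν z x = 0 := fun ν hν x => by simp [hz, hν]
  refine ⟨z, ⟨?_, ?_, ?_, ?_⟩, h1, h2⟩
  · rw [Semigroup.mem_center_iff]
    intro b
    refine D.ext_actF F fun ν x => ?_
    rw [actF_mul, actF_mul]
    by_cases hν : ν = μ
    · subst hν; simp [h1]
    · simp [h2 ν hν]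
  · refine D.ext_actF F fun ν x => ?_
    rw [actF_mul]
    by_cases hν : ν = μ
    · subst hν; simp [h1]
    · simp [h2 ν hν]
  · rintro rfl
    obtain ⟨x, hx⟩ := exists_ne (0 : F ⊗[R] D.Cell μ)
    exact hx (by simpa using (h1 x).symm)
  · intro e he hee hez
    have h3 : ∀ ν, ν ≠ μ → ∀ x, D.actF F ν e x = 0 := by
      intro ν hν x
      rw [← hez, actF_mul, h2 ν hν]
    have hc : D.actF F μ e ∈ Subalgebra.center F (Module.End F (F ⊗[R] D.Cell μ)) := by
      rw [Subalgebra.mem_center_iff]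
      intro b
      obtain ⟨b', hb'⟩ := D.exists_actF_eq F (Pi.single μ b)
      have hb : D.actF F μ b' = b := by simp [hb']
      have h4 := (Semigroup.mem_center_iff.mp he b')
      refine LinearMap.ext fun x => ?_
      have h5 := congrArg (fun a => D.actF F μ a x) h4
      simpa [actF_mul, hb] using h5.symm
    rw [Algebra.IsCentral.center_eq_bot, Algebra.mem_bot] at hc
    obtain ⟨c, hc⟩ := hc
    have h4 : ∀ x, D.actF F μ e x = c • x := fun x => by
      rw [← hc, Module.algebraMap_end_apply]
    obtain ⟨x, hx⟩ := exists_ne (0 : F ⊗[R] D.Cell μ)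
    have h5 : (c * c) • x = c • x := by
      rw [mul_smul, ← h4 x, ← h4, ← actF_mul, hee]
    have h6 : c * c = c := smul_left_injective F hx h5
    have h7 : c = 0 ∨ c = 1 := by
      rcases eq_or_ne c 0 with h | h
      · exact Or.inl h
      · exact Or.inr (mul_left_cancel₀ h (by rw [h6, mul_one]))
    rcases h7 with rfl | rfl
    · left
      refine D.ext_actF F fun ν x => ?_
      by_cases hν : ν = μ
      · subst hν; simp [h4]
      · simp [h3 ν hν]
    · right
      refine D.ext_actF F fun ν x => ?_
      by_cases hν : ν = μ
      · subst hν; simp [h4, h1]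
      · simp [h3 ν hν, h2 ν hν]

/-- Elements of `A^{⊵ ν}` act as zero on `Δ(κ)` unless `κ ⊵ ν`. -/
theorem act_eq_zero_of_mem_idealGE {ν κ : L} (h : ¬ κ ≥ ν) {a : A} (ha : a ∈ D.idealGE ν) :
    D.act κ a = 0 := by
  have key : ∀ x ∈ D.idealGE ν, ∀ s v : I κ, D.basis.repr x ⟨κ, (s, v)⟩ = 0 := by
    intro x hx s v
    induction hx using Submodule.span_induction with
    | mem x hx =>
      obtain ⟨ρ, hρ, p, q, rfl⟩ := hx
      rw [Module.Basis.repr_self, Finsupp.single_apply_eq_zero]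
      intro h'
      obtain rfl : κ = ρ := congrArg Sigma.fst h'
      exact absurd hρ h
    | zero => simp
    | add x y _ _ hx hy => simp [hx, hy]
    | smul c x _ hx => simp [hx]
  ext1 x
  funext v
  simp [act_apply, coeff, key _ (D.idealGE_mul_left ν ha _)]

theorem actF_one_tmul_eq_zero_of_mem_idealGE {ν κ : L} (h : ¬ κ ≥ ν) {a : A}
    (ha : a ∈ D.idealGE ν) (x : F ⊗[R] D.Cell κ) : D.actF F κ (1 ⊗ₜ a) x = 0 := by
  induction x using TensorProduct.induction_on with
  | zero => simp
  | tmul q x => rw [actF_tmul, D.act_eq_zero_of_mem_idealGE h ha, LinearMap.zero_apply,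
      TensorProduct.tmul_zero]
  | add x y hx hy => rw [map_add, hx, hy, add_zero]

end

end CellDatum

/-! ### Extension of scalars to the field of fractions -/

theorem IsSplitSemisimple.isSemisimpleRing {F B : Type*} [Field F] [Ring B] [Algebra F B]
    (h : IsSplitSemisimple F B) : IsSemisimpleRing B := by
  obtain ⟨n, d, -, ⟨e⟩⟩ := h
  exact e.symm.toRingEquiv.isSemisimpleRing

section

variable {R F : Type*} [CommRing R] [IsDomain R] [Field F] [Algebra R F] [IsFractionRing R F]
  {N : Type*} [AddCommGroup N] [Module R N]

/-- Clearing denominators in `F ⊗ N`. -/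
theorem exists_smul_eq_one_tmul (x : F ⊗[R] N) :
    ∃ (b : F) (y : N), b ≠ 0 ∧ b • x = 1 ⊗ₜ y := by
  obtain ⟨⟨y, d⟩, h⟩ := IsLocalizedModule.surj (nonZeroDivisors R) (TensorProduct.mk R F N 1) x
  refine ⟨algebraMap R F d, y, IsFractionRing.to_map_ne_zero_of_mem_nonZeroDivisors d.2, ?_⟩
  rw [algebraMap_smul]
  exact h

variable (F) in
theorem eq_zero_of_one_tmul_eq_zero [Module.IsTorsionFree R N] {y : N}
    (h : (1 : F) ⊗ₜ[R] y = 0) : y = 0 := by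
  obtain ⟨c, hc⟩ := (IsLocalizedModule.eq_zero_iff (nonZeroDivisors R)
    (TensorProduct.mk R F N 1)).mp h
  exact (smul_eq_zero.mp hc).resolve_left (nonZeroDivisors.ne_zero c.2)

end

namespace CellularTower

section

variable {R : Type*} [CommRing R] {A : ℕ → Type*} [∀ r, Ring (A r)]
  [∀ r, Algebra R (A r)] {L : ℕ → Type*} [∀ r, PartialOrder (L r)]
  {I : ∀ r, L r → Type*} [∀ r μ, Fintype (I r μ)] (T : CellularTower R A L I)
  (F : Type*) [Field F] [Algebra R F]

theorem inclF_tmul (r : ℕ) (p : F) (a : A r) : T.inclF F r (p ⊗ₜ a) = p ⊗ₜ T.incl r a := by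
  simp [inclF]

/-! ### Block idempotents -/

section Idempotents

variable [Nontrivial R] [∀ r, Finite (L r)] [∀ r μ, Nonempty (I r μ)]
  [∀ r, IsSemisimpleRing (F ⊗[R] A r)]

theorem centralIdempotent_spec (r : ℕ) (μ : L r) :
    IsMinimalCentralIdempotent (T.centralIdempotent F r μ) ∧
      ∀ x, (T.datum r).actF F μ (T.centralIdempotent F r μ) x = x := by
  obtain ⟨z, hz, h1, -⟩ := (T.datum r).exists_blockIdempotent F μ
  exact Classical.epsilon_spec
    (p := fun z => IsMinimalCentralIdempotent z ∧ ∀ x, (T.datum r).actF F μ z x = x) ⟨z, hz, h1⟩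

theorem actF_centralIdempotent_self (r : ℕ) (μ : L r) (x : F ⊗[R] T.Cell r μ) :
    (T.datum r).actF F μ (T.centralIdempotent F r μ) x = x :=
  (T.centralIdempotent_spec F r μ).2 x

theorem mul_centralIdempotent_comm (r : ℕ) (μ : L r) (a : F ⊗[R] A r) :
    a * T.centralIdempotent F r μ = T.centralIdempotent F r μ * a :=
  Semigroup.mem_center_iff.mp (T.centralIdempotent_spec F r μ).1.1 a

theorem centralIdempotent_mul_self (r : ℕ) (μ : L r) :
    T.centralIdempotent F r μ * T.centralIdempotent F r μ = T.centralIdempotent F r μ :=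
  (T.centralIdempotent_spec F r μ).1.2.1

theorem actF_centralIdempotent_of_ne (r : ℕ) {μ ν : L r} (h : ν ≠ μ) (x : F ⊗[R] T.Cell r ν) :
    (T.datum r).actF F ν (T.centralIdempotent F r μ) x = 0 := by
  obtain ⟨⟨-, -, -, hmin⟩, h1⟩ := T.centralIdempotent_spec F r μ
  obtain ⟨e, ⟨hec, hee, he0, -⟩, he1, he2⟩ := (T.datum r).exists_blockIdempotent F μ
  -- the epsilon term is some idempotent with the defining property; minimality forces it to be `e`
  have hez : e * T.centralIdempotent F r μ = e := by
    refine (T.datum r).ext_actF F fun κ x => ?_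
    rw [CellDatum.actF_mul]
    by_cases hκ : κ = μ
    · subst hκ; simp [h1]
    · simp [he2 κ hκ]
  rw [← (hmin e hec hee hez).resolve_left he0]
  exact he2 ν h x

theorem centralIdempotent_mul_of_ne (r : ℕ) {μ ν : L r} (h : ν ≠ μ) :
    T.centralIdempotent F r ν * T.centralIdempotent F r μ = 0 := by
  refine (T.datum r).ext_actF F fun κ x => ?_
  rw [CellDatum.actF_mul, map_zero, LinearMap.zero_apply]
  by_cases hκ : κ = μ
  · subst hκ
    rw [T.actF_centralIdempotent_of_ne F r h.symm, map_zero]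
  · exact T.actF_centralIdempotent_of_ne F r hκ _

theorem sum_centralIdempotent (r : ℕ) [Fintype (L r)] :
    ∑ μ, T.centralIdempotent F r μ = 1 := by
  refine (T.datum r).ext_actF F fun κ x => ?_
  rw [map_sum, LinearMap.sum_apply, CellDatum.actF_one, Finset.sum_eq_single κ]
  · exact T.actF_centralIdempotent_self F r κ x
  · intro μ _ hμ
    exact T.actF_centralIdempotent_of_ne F r hμ.symm x
  · simp

/-- The ideal `A^{⊵ ν}` only meets the blocks of labels `κ ⊵ ν`. -/
theorem tmul_mul_centralIdempotent_eq_zero (r : ℕ) {ν κ : L r} (h : ¬ κ ≥ ν) {a : A r}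
    (ha : a ∈ (T.datum r).idealGE ν) :
    ((1 : F) ⊗ₜ[R] a) * T.centralIdempotent F r κ = 0 := by
  refine (T.datum r).ext_actF F fun ρ x => ?_
  rw [T.mul_centralIdempotent_comm, CellDatum.actF_mul, map_zero, LinearMap.zero_apply]
  by_cases hρ : ρ = κ
  · subst hρ
    exact (T.datum r).actF_one_tmul_eq_zero_of_mem_idealGE F h ha _
  · rw [T.actF_centralIdempotent_of_ne F r hρ, map_zero]

end Idempotents

/-! ### Cell-filtrations over the field of fractions -/

namespace CellFiltration

variable {T} {r : ℕ} {μ : L (r + 1)} (𝓜 : T.CellFiltration r μ)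

theorem label_injective : Function.Injective 𝓜.label := 𝓜.label_strictAnti.injective

theorem actF_mem_baseChange (i : Fin (𝓜.len + 1)) (a : F ⊗[R] A r)
    {x : F ⊗[R] T.Cell (r + 1) μ} (hx : x ∈ (𝓜.M i).baseChange F) :
    (T.datum (r + 1)).actF F μ (T.inclF F r a) x ∈ (𝓜.M i).baseChange F := by
  rw [Submodule.baseChange_eq_span] at hx
  induction hx using Submodule.span_induction with
  | mem x hx =>
    obtain ⟨y, hy, rfl⟩ := hx
    induction a using TensorProduct.induction_on with
    | zero => simp
    | tmul p a =>
      rw [inclF_tmul, TensorProduct.mk_apply, CellDatum.actF_tmul]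
      exact Submodule.tmul_mem_baseChange_of_mem _ (𝓜.stable i a y hy)
    | add a b ha hb => rw [map_add, map_add]; exact Submodule.add_mem _ ha hb
  | zero => simp
  | add x y _ _ hx hy => rw [map_add]; exact Submodule.add_mem _ hx hy
  | smul c x _ hx => rw [map_smul]; exact Submodule.smul_mem _ _ hx

variable [IsFractionRing R F]

/-- A cell-filtration stays one over `F`, because `F` is flat over `R`: the projections to the
subquotients. -/
theorem exists_proj (i : Fin 𝓜.len) :
    ∃ π : (𝓜.M i.succ).baseChange F →ₗ[F] F ⊗[R] T.Cell r (𝓜.label i),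
      Function.Surjective π ∧
      (∀ x, π x = 0 → (x : F ⊗[R] T.Cell (r + 1) μ) ∈ (𝓜.M i.castSucc).baseChange F) ∧
      (∀ a x, π ⟨_, 𝓜.actF_mem_baseChange F i.succ a x.2⟩ =
        (T.datum r).actF F (𝓜.label i) a (π x)) ∧
      ∀ x (hx : x ∈ 𝓜.M i.succ), π ⟨1 ⊗ₜ x, Submodule.tmul_mem_baseChange_of_mem _ hx⟩ =
        1 ⊗ₜ 𝓜.iso i (Submodule.Quotient.mk ⟨x, hx⟩) := by
  have : Module.Flat R F := IsLocalization.flat F (nonZeroDivisors R)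
  let ι := (𝓜.M i.succ).subtype.baseChange F
  have hι : Function.Injective ι :=
    Module.Flat.lTensor_preserves_injective_linearMap _ (𝓜.M i.succ).injective_subtype
  let σ : F ⊗[R] 𝓜.M i.succ ≃ₗ[F] (𝓜.M i.succ).baseChange F := LinearEquiv.ofInjective ι hι
  let q : 𝓜.M i.succ →ₗ[R] T.Cell r (𝓜.label i) :=
    (𝓜.iso i).toLinearMap ∘ₗ Submodule.mkQ _
  have hq : Function.Surjective q :=
    (𝓜.iso i).surjective.comp (Submodule.mkQ_surjective _)
  have hex : Function.Exact (Submodule.inclusion (𝓜.M_le i)) q := by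
    intro x
    have h1 : q x = 0 ↔ (x : T.Cell (r + 1) μ) ∈ 𝓜.M i.castSucc := by
      simp only [q, LinearMap.comp_apply, LinearEquiv.coe_coe, LinearEquiv.map_eq_zero_iff,
        Submodule.mkQ_apply, Submodule.Quotient.mk_eq_zero]
      rfl
    rw [h1]
    constructor
    · intro h
      exact ⟨⟨x, h⟩, rfl⟩
    · rintro ⟨y, rfl⟩
      exact y.2
  have hsymm : ∀ x (hx : x ∈ 𝓜.M i.succ) (p : F),
      σ.symm ⟨p ⊗ₜ x, Submodule.tmul_mem_baseChange_of_mem _ hx⟩ = p ⊗ₜ ⟨x, hx⟩ := by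
    intro x hx p
    rw [LinearEquiv.symm_apply_eq]
    rfl
  refine ⟨q.baseChange F ∘ₗ σ.symm.toLinearMap, ?_, ?_, ?_, ?_⟩
  · exact (LinearMap.lTensor_surjective F hq).comp σ.symm.surjective
  · intro x hx
    obtain ⟨y, hy⟩ := (lTensor_exact F hex hq (σ.symm x)).mp hx
    have hx' : x = σ (LinearMap.lTensor F (Submodule.inclusion (𝓜.M_le i)) y) := by
      rw [hy, LinearEquiv.apply_symm_apply]
    rw [hx']
    clear hy hx'
    induction y using TensorProduct.induction_on with
    | zero => simp
    | tmul p y => exact Submodule.tmul_mem_baseChange_of_mem p y.2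
    | add y y' h h' => rw [map_add, map_add]; exact Submodule.add_mem _ h h'
  · intro a x
    obtain ⟨y, rfl⟩ := σ.surjective x
    induction y using TensorProduct.induction_on with
    | zero =>
      have h0 : (⟨_, 𝓜.actF_mem_baseChange F i.succ a (σ 0).2⟩ :
          (𝓜.M i.succ).baseChange F) = 0 := Subtype.ext (by simp)
      rw [h0, LinearEquiv.map_zero σ, LinearMap.map_zero, LinearMap.map_zero]
    | add y y' h h' =>
      have h0 : (⟨_, 𝓜.actF_mem_baseChange F i.succ a (σ (y + y')).2⟩ :
          (𝓜.M i.succ).baseChange F) = ⟨_, 𝓜.actF_mem_baseChange F i.succ a (σ y).2⟩ +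
            ⟨_, 𝓜.actF_mem_baseChange F i.succ a (σ y').2⟩ := Subtype.ext (by simp)
      rw [h0, map_add, h, h', map_add σ, map_add, map_add]
    | tmul p y =>
      induction a using TensorProduct.induction_on with
      | zero =>
        have h0 : (⟨_, 𝓜.actF_mem_baseChange F i.succ 0 (σ (p ⊗ₜ y)).2⟩ :
            (𝓜.M i.succ).baseChange F) = 0 := Subtype.ext (by simp)
        rw [h0, LinearMap.map_zero, LinearMap.map_zero, LinearMap.zero_apply]
      | add a a' h h' =>
        have h0 : (⟨_, 𝓜.actF_mem_baseChange F i.succ (a + a') (σ (p ⊗ₜ y)).2⟩ :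
            (𝓜.M i.succ).baseChange F) =
            ⟨_, 𝓜.actF_mem_baseChange F i.succ a (σ (p ⊗ₜ y)).2⟩ +
              ⟨_, 𝓜.actF_mem_baseChange F i.succ a' (σ (p ⊗ₜ y)).2⟩ := Subtype.ext (by simp)
        rw [h0, map_add, h, h', map_add, LinearMap.add_apply]
      | tmul c a =>
        have h0 : (⟨_, 𝓜.actF_mem_baseChange F i.succ (c ⊗ₜ a) (σ (p ⊗ₜ y)).2⟩ :
            (𝓜.M i.succ).baseChange F) = ⟨(c * p) ⊗ₜ _,
              Submodule.tmul_mem_baseChange_of_mem _ (𝓜.stable i.succ a y y.2)⟩ := by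
          refine Subtype.ext ?_
          change (T.datum (r + 1)).actF F μ (T.inclF F r (c ⊗ₜ a)) (p ⊗ₜ (y : T.Cell (r + 1) μ)) = _
          rw [inclF_tmul, CellDatum.actF_tmul]
        rw [h0, LinearMap.comp_apply, LinearEquiv.coe_coe, hsymm, LinearMap.comp_apply,
          LinearEquiv.coe_coe, LinearEquiv.symm_apply_apply, LinearMap.baseChange_tmul,
          LinearMap.baseChange_tmul, CellDatum.actF_tmul]
        congr 1
        exact 𝓜.iso_act i a y
  · intro x hx
    rw [LinearMap.comp_apply, LinearEquiv.coe_coe, hsymm, LinearMap.baseChange_tmul]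
    rfl

variable [Nontrivial R] [∀ r, Finite (L r)] [∀ r μ, Nonempty (I r μ)]
  [∀ r, IsSemisimpleRing (F ⊗[R] A r)]

/-- A vector in the block of `ν` passes down through a subquotient with another label. -/
theorem mem_baseChange_castSucc {ν : L r} {x : F ⊗[R] T.Cell (r + 1) μ}
    (hx : (T.datum (r + 1)).actF F μ (T.inclF F r (T.centralIdempotent F r ν)) x = x)
    (i : Fin 𝓜.len) (hi : 𝓜.label i ≠ ν) (h : x ∈ (𝓜.M i.succ).baseChange F) :
    x ∈ (𝓜.M i.castSucc).baseChange F := by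
  obtain ⟨π, -, hker, hact, -⟩ := 𝓜.exists_proj F i
  refine hker ⟨x, h⟩ ?_
  have h1 := hact (T.centralIdempotent F r ν) ⟨x, h⟩
  rw [T.actF_centralIdempotent_of_ne F r hi] at h1
  rw [← h1]
  congr 2
  exact hx.symm

/-- A vector in the block of `ν` lies in `M j` if `ν` is not the label of a subquotient above
`M j`. -/
theorem mem_baseChange_of_label_ne {ν : L r} {x : F ⊗[R] T.Cell (r + 1) μ}
    (hx : (T.datum (r + 1)).actF F μ (T.inclF F r (T.centralIdempotent F r ν)) x = x)
    (j : Fin (𝓜.len + 1)) (hj : ∀ i : Fin 𝓜.len, j ≤ i.castSucc → 𝓜.label i ≠ ν) :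
    x ∈ (𝓜.M j).baseChange F := by
  induction j using Fin.reverseInduction with
  | last => rw [𝓜.M_last, Submodule.baseChange_top]; trivial
  | cast i ih =>
    exact 𝓜.mem_baseChange_castSucc F hx i (hj i le_rfl)
      (ih fun i' hi' => hj i' (Fin.castSucc_lt_succ.le.trans hi'))

/-- A vector of `M j` in the block of `ν` is zero if `ν` is not the label of a subquotient below
`M j`. -/
theorem eq_zero_of_mem_baseChange {ν : L r} {x : F ⊗[R] T.Cell (r + 1) μ}
    (hx : (T.datum (r + 1)).actF F μ (T.inclF F r (T.centralIdempotent F r ν)) x = x)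
    (j : Fin (𝓜.len + 1)) (hj : ∀ i : Fin 𝓜.len, i.castSucc < j → 𝓜.label i ≠ ν)
    (h : x ∈ (𝓜.M j).baseChange F) : x = 0 := by
  induction j using Fin.induction with
  | zero => simpa [𝓜.M_zero] using h
  | succ i ih =>
    exact ih (fun i' hi' => hj i' (hi'.trans Fin.castSucc_lt_succ))
      (𝓜.mem_baseChange_castSucc F hx i (hj i Fin.castSucc_lt_succ) h)

/-- The block of `ν` is trivial in `Δ^F(μ)` if `ν` is not a label of the filtration. -/
theorem actF_centralIdempotent_eq_zero {ν : L r} (hν : ∀ i, 𝓜.label i ≠ ν)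
    (x : F ⊗[R] T.Cell (r + 1) μ) :
    (T.datum (r + 1)).actF F μ (T.inclF F r (T.centralIdempotent F r ν)) x = 0 := by
  have h1 : (T.datum (r + 1)).actF F μ (T.inclF F r (T.centralIdempotent F r ν))
      ((T.datum (r + 1)).actF F μ (T.inclF F r (T.centralIdempotent F r ν)) x) =
      (T.datum (r + 1)).actF F μ (T.inclF F r (T.centralIdempotent F r ν)) x := by
    rw [← CellDatum.actF_mul, ← map_mul, T.centralIdempotent_mul_self]
  exact 𝓜.eq_zero_of_mem_baseChange F h1 0 (fun i _ => hν i)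
    (𝓜.mem_baseChange_of_label_ne F h1 0 fun i _ => hν i)

/-- Over `F`, the cell module of a label `ν` of the filtration embeds as the block of `ν` in
`Δ^F(μ)`: the projection to the subquotient is bijective on this block. -/
theorem exists_embedding (i : Fin 𝓜.len) :
    ∃ ψ : F ⊗[R] T.Cell r (𝓜.label i) →ₗ[F] F ⊗[R] T.Cell (r + 1) μ,
      Function.Injective ψ ∧
      (∀ a w, ψ ((T.datum r).actF F (𝓜.label i) a w) =
        (T.datum (r + 1)).actF F μ (T.inclF F r a) (ψ w)) ∧
      (∀ v, ∃ w, ψ w = (T.datum (r + 1)).actF F μ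
        (T.inclF F r (T.centralIdempotent F r (𝓜.label i))) v) ∧
      ∀ x (hx : x ∈ 𝓜.M i.succ), ψ (1 ⊗ₜ 𝓜.iso i (Submodule.Quotient.mk ⟨x, hx⟩)) =
        (T.datum (r + 1)).actF F μ (T.inclF F r (T.centralIdempotent F r (𝓜.label i)))
          (1 ⊗ₜ x) := by
  obtain ⟨π, hsurj, hker, hact, hiso⟩ := 𝓜.exists_proj F i
  set z := T.centralIdempotent F r (𝓜.label i) with hz
  let Z := (T.datum (r + 1)).actF F μ (T.inclF F r z)
  have hZZ : ∀ x, Z (Z x) = Z x := by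
    intro x
    simp only [Z]
    rw [← CellDatum.actF_mul, ← map_mul, T.centralIdempotent_mul_self]
  -- `E` is the block of `label i`; the projection `π` restricts to a bijection `g` on it
  let E : Submodule F (F ⊗[R] T.Cell (r + 1) μ) := LinearMap.eqLocus Z LinearMap.id
  have hE : ∀ x : E, Z x = x := fun x => x.2
  have hmem : ∀ x : E, (x : F ⊗[R] T.Cell (r + 1) μ) ∈ (𝓜.M i.succ).baseChange F := by
    intro x
    refine 𝓜.mem_baseChange_of_label_ne F (hE x) i.succ fun i' hi' h => ?_
    obtain rfl := 𝓜.label_injective h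
    exact absurd hi' (not_le.mpr Fin.castSucc_lt_succ)
  let g : E →ₗ[F] F ⊗[R] T.Cell r (𝓜.label i) :=
    π ∘ₗ LinearMap.codRestrict _ E.subtype hmem
  have hg : ∀ (x : E) y (h : y ∈ (𝓜.M i.succ).baseChange F), (x : F ⊗[R] _) = y →
      g x = π ⟨y, h⟩ := by
    rintro x y h rfl
    rfl
  have hginj : Function.Injective g := by
    rw [injective_iff_map_eq_zero]
    intro x hx
    refine Subtype.ext (𝓜.eq_zero_of_mem_baseChange F (hE x) i.castSucc ?_ (hker _ hx))
    intro i' hi' h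
    obtain rfl := 𝓜.label_injective h
    exact lt_irrefl _ hi'
  have hπz : ∀ y : (𝓜.M i.succ).baseChange F, g ⟨Z y, hZZ y⟩ = π y := by
    intro y
    rw [hg _ _ (𝓜.actF_mem_baseChange F i.succ z y.2) rfl, hact,
      T.actF_centralIdempotent_self]
  have hgsurj : Function.Surjective g := by
    intro w
    obtain ⟨y, rfl⟩ := hsurj w
    exact ⟨_, hπz y⟩
  let e := LinearEquiv.ofBijective g ⟨hginj, hgsurj⟩
  have he : ∀ x, e x = g x := fun x => rfl
  refine ⟨E.subtype ∘ₗ e.symm.toLinearMap, E.injective_subtype.comp e.symm.injective, ?_, ?_, ?_⟩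
  · intro a w
    obtain ⟨x, rfl⟩ := e.surjective w
    have hax : Z ((T.datum (r + 1)).actF F μ (T.inclF F r a) x) =
        (T.datum (r + 1)).actF F μ (T.inclF F r a) x := by
      conv_rhs => rw [← hE x]
      simp only [Z]
      rw [← CellDatum.actF_mul, ← CellDatum.actF_mul, ← map_mul, ← map_mul,
        T.mul_centralIdempotent_comm]
    have h1 : (T.datum r).actF F (𝓜.label i) a (e x) = e ⟨_, hax⟩ := by
      rw [he, he, hg ⟨_, hax⟩ _ (𝓜.actF_mem_baseChange F i.succ a (hmem x)) rfl]
      exact (hact a ⟨x, hmem x⟩).symm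
    rw [h1]
    simp
  · intro v
    exact ⟨e ⟨Z v, hZZ v⟩, by simp [Z]⟩
  · intro x hx
    rw [← hiso x hx, ← hπz, ← he]
    simp [Z]

end CellFiltration

end

end CellularTower

/-! ### Paths and Gelfand–Zeitlin idempotents -/

namespace CellularTower

section

variable {R : Type*} [CommRing R] {A : ℕ → Type*} [∀ r, Ring (A r)]
  [∀ r, Algebra R (A r)] {L : ℕ → Type*} [∀ r, PartialOrder (L r)]
  {I : ∀ r, L r → Type*} [∀ r μ, Fintype (I r μ)] {T : CellularTower R A L I}

/-- A path to `ν` can be extended by an edge `ν → μ`. -/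
theorem Std.exists_snoc {r : ℕ} {ν : L r} {μ : L (r + 1)} (s : T.Std r ν) (h : T.Edge r ν μ) :
    ∃ t : T.Std (r + 1) μ,
      ∀ j (hj : j ≤ r), t.vertex j (hj.trans (Nat.le_succ r)) = s.vertex j hj := by
  refine ⟨⟨fun j hj => if h : j ≤ r then s.vertex j h else
    (le_antisymm (not_le.mp h) hj : r + 1 = j) ▸ μ, ?_, ?_⟩, ?_⟩
  · intro j hj
    rcases (Nat.le_of_succ_le_succ hj).eq_or_lt with rfl | hlt
    · simpa [s.vertex_last] using h
    · simpa [hlt.le, Nat.succ_le_of_lt hlt] using s.edge j hlt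
  · simp
  · intro j hj
    simp [hj]

variable (F : Type*) [Field F] [Algebra R F]

theorem gzIdempotent_congr {r : ℕ} {μ ν : L r} {s : T.Std r μ} {t : T.Std r ν}
    (h : ∀ j hj, s.vertex j hj = t.vertex j hj) : T.gzIdempotent F s = T.gzIdempotent F t := by
  obtain rfl : μ = ν := by rw [← s.vertex_last, ← t.vertex_last, h]
  obtain rfl : s = t := by
    ext j hj
    exact h j hj
  rfl

section Idempotents

variable [Nontrivial R] [∀ r, Finite (L r)] [∀ r μ, Nonempty (I r μ)]
  [∀ r, IsSemisimpleRing (F ⊗[R] A r)]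

theorem gzIdempotent_mul_self {r : ℕ} {μ : L r} (t : T.Std r μ) :
    T.gzIdempotent F t * T.gzIdempotent F t = T.gzIdempotent F t := by
  induction r with
  | zero => exact one_mul 1
  | succ r ih =>
    rw [gzIdempotent, mul_assoc, ← mul_assoc (T.centralIdempotent F _ _) (T.inclF F r _),
      ← T.mul_centralIdempotent_comm, mul_assoc, T.centralIdempotent_mul_self, ← mul_assoc,
      ← map_mul, ih]

theorem gzIdempotent_mul_of_ne [Subsingleton (L 0)] {r : ℕ} {μ ν : L r} (s : T.Std r μ)
    (t : T.Std r ν) (h : ∃ j hj, s.vertex j hj ≠ t.vertex j hj) :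
    T.gzIdempotent F s * T.gzIdempotent F t = 0 := by
  induction r with
  | zero =>
    obtain ⟨j, hj, h⟩ := h
    obtain rfl := Nat.le_zero.mp hj
    exact absurd (Subsingleton.elim _ _) h
  | succ r ih =>
    rw [gzIdempotent, gzIdempotent, mul_assoc, ← mul_assoc (T.centralIdempotent F _ _),
      ← T.mul_centralIdempotent_comm, mul_assoc, ← mul_assoc, ← map_mul]
    by_cases hl : s.vertex (r + 1) le_rfl = t.vertex (r + 1) le_rfl
    · obtain ⟨j, hj, h⟩ := h
      rcases Nat.of_le_succ hj with hj' | rfl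
      · rw [ih s.trunc t.trunc ⟨j, hj', h⟩, map_zero, zero_mul]
      · exact absurd hl h
    · rw [T.centralIdempotent_mul_of_ne F _ hl, mul_zero]

/-- The product that defines `F_t` starts at level `1`; the factor of level `0` may be added
since it equals `1`. -/
theorem centralIdempotent_mul_gzIdempotent [Subsingleton (L 0)] {r : ℕ} {μ : L r}
    (t : T.Std r μ) : T.centralIdempotent F r μ * T.gzIdempotent F t = T.gzIdempotent F t := by
  cases r with
  | zero =>
    have := Fintype.ofFinite (L 0)
    have h := T.sum_centralIdempotent F 0
    rw [Fintype.sum_subsingleton _ μ] at h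
    rw [h, one_mul]
  | succ r =>
    rw [gzIdempotent, t.vertex_last, ← T.mul_centralIdempotent_comm, mul_assoc,
      T.centralIdempotent_mul_self]

end Idempotents

/-! ### Murphy vectors and seminormal vectors -/

namespace MurphyData

variable (C : T.MurphyData)

theorem gen_ne_zero [Nontrivial R] (r : ℕ) (μ : L r) [Nonempty (I r μ)] : C.gen r μ ≠ 0 := by
  intro h
  obtain ⟨a, ha⟩ := C.gen_spec r μ 1
  rw [h, map_zero] at ha
  exact zero_ne_one ha

/-- A vector `δ a` of the cell module vanishes if `m_μ a` does, as `m_μ a` corresponds to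
`δ ⊗ δ a`; this also holds over `F`, by clearing denominators. -/
theorem actF_gen_eq_zero [IsDomain R] [IsFractionRing R F] [∀ r μ, Nonempty (I r μ)]
    (r : ℕ) (μ : L r) {Y : F ⊗[R] A r} (h : (1 : F) ⊗ₜ[R] (C.m r μ : A r) * Y = 0) :
    (T.datum r).actF F μ Y (1 ⊗ₜ C.gen r μ) = 0 := by
  obtain ⟨b, y, hb, hy⟩ := exists_smul_eq_one_tmul (R := R) Y
  have : Module.Free R (A r) := Module.Free.of_basis (T.datum r).basis
  have hmy : (C.m r μ : A r) * y = 0 := by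
    apply eq_zero_of_one_tmul_eq_zero (R := R) F
    rw [← mul_one (1 : F), ← Algebra.TensorProduct.tmul_mul_tmul, ← hy, mul_smul_comm, h, smul_zero]
  have h1 : C.gen r μ ⊗ₜ[R] (T.datum r).act μ y (C.gen r μ) = 0 := by
    rw [← C.alpha_m_mul, ← map_zero (C.alpha r μ)]
    congr 1
    rw [Submodule.Quotient.mk_eq_zero]
    change (C.m r μ : A r) * y ∈ (T.datum r).idealGT μ
    rw [hmy]
    exact Submodule.zero_mem _
  -- contract the first tensor factor with a coordinate in which `δ` is nonzero
  obtain ⟨i, hi⟩ := Function.ne_iff.mp (C.gen_ne_zero r μ)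
  have h2 := congrArg (TensorProduct.lift (LinearMap.lsmul R (T.Cell r μ) ∘ₗ
    (LinearMap.proj i : T.Cell r μ →ₗ[R] R))) h1
  have h3 : (T.datum r).act μ y (C.gen r μ) = 0 := by
    rw [map_zero, TensorProduct.lift.tmul] at h2
    exact (smul_eq_zero.mp h2).resolve_left hi
  have h4 : b • (T.datum r).actF F μ Y (1 ⊗ₜ C.gen r μ) = 0 := by
    rw [← LinearMap.smul_apply, ← map_smul, hy, CellDatum.actF_tmul, h3, TensorProduct.tmul_zero]
  exact (smul_eq_zero.mp h4).resolve_left hb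

section

variable [Nontrivial R] [∀ r, Finite (L r)]

variable {C} in
/-- Since `A_0 = R` has rank one, its cellular basis consists of one element. -/
theorem IsDiagramTower.subsingleton_index_zero {F : Type*} [Field F] [Algebra R F]
    (hC : C.IsDiagramTower F) : Subsingleton (Σ μ : L 0, I 0 μ × I 0 μ) := by
  have := Fintype.ofFinite (L 0)
  rw [← Fintype.card_le_one_iff_subsingleton, ← Module.finrank_eq_card_basis (T.datum 0).basis,
    ← (LinearEquiv.ofBijective (Algebra.linearMap R (A 0)) hC.base).finrank_eq,
    Module.finrank_self]

variable [∀ r μ, Nonempty (I r μ)]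

variable {C} in
theorem IsDiagramTower.subsingleton_label_zero {F : Type*} [Field F] [Algebra R F]
    (hC : C.IsDiagramTower F) : Subsingleton (L 0) := by
  have := hC.subsingleton_index_zero
  refine ⟨fun μ ν => ?_⟩
  obtain ⟨p⟩ := (inferInstance : Nonempty (I 0 μ))
  obtain ⟨q⟩ := (inferInstance : Nonempty (I 0 ν))
  exact congrArg Sigma.fst (Subsingleton.elim
    (⟨μ, (p, p)⟩ : Σ μ : L 0, I 0 μ × I 0 μ) ⟨ν, (q, q)⟩)

variable {C} in
theorem IsDiagramTower.finrank_cell_zero {F : Type*} [Field F] [Algebra R F]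
    (hC : C.IsDiagramTower F) (μ : L 0) : Module.finrank F (F ⊗[R] T.Cell 0 μ) = 1 := by
  have := hC.subsingleton_index_zero
  rw [Module.finrank_baseChange, Module.finrank_fintype_fun_eq_card]
  refine le_antisymm (Fintype.card_le_one_iff_subsingleton.mpr ⟨fun p q => ?_⟩) Fintype.card_pos
  have h := Subsingleton.elim (⟨μ, (p, p)⟩ : Σ μ : L 0, I 0 μ × I 0 μ) ⟨μ, (q, q)⟩
  simpa using h

/-- The edges of the branching diagram can be read off from the chosen filtrations: the labels of
any cell-filtration are the blocks that are nonzero over `F`. -/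
theorem exists_label_eq (F : Type*) [Field F] [Algebra R F] [IsFractionRing R F]
    [∀ r, IsSemisimpleRing (F ⊗[R] A r)] {r : ℕ} {ν : L r} {μ : L (r + 1)} (h : T.Edge r ν μ) :
    ∃ i, (C.filtration r μ).label i = ν := by
  obtain ⟨𝓜, i, rfl⟩ := h
  by_contra! hne
  obtain ⟨ψ, hinj, hact, -, -⟩ := 𝓜.exists_embedding F i
  have := (T.datum r).nontrivial_cellF F (𝓜.label i)
  obtain ⟨x, hx⟩ := exists_ne (0 : F ⊗[R] T.Cell r (𝓜.label i))
  refine hx (hinj ?_)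
  rw [map_zero, ← T.actF_centralIdempotent_self F r _ x, hact]
  exact (C.filtration r μ).actF_centralIdempotent_eq_zero F hne _

variable [∀ r, IsSemisimpleRing (F ⊗[R] A r)]

theorem actF_inclF_gzIdempotent [Subsingleton (L 0)] {r : ℕ} {ν : L r} {μ : L (r + 1)}
    (s : T.Std r ν) (x : F ⊗[R] T.Cell (r + 1) μ) :
    (T.datum (r + 1)).actF F μ (T.inclF F r (T.gzIdempotent F s)) x =
      (T.datum (r + 1)).actF F μ (T.inclF F r (T.gzIdempotent F s))
        ((T.datum (r + 1)).actF F μ (T.inclF F r (T.centralIdempotent F r ν)) x) := by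
  rw [← CellDatum.actF_mul, ← map_mul, centralIdempotent_mul_gzIdempotent]

/-- On a cell module the last factor of `F_t` acts as the identity. -/
theorem actF_gzIdempotent_succ {r : ℕ} {μ : L (r + 1)} (t : T.Std (r + 1) μ)
    (v : F ⊗[R] T.Cell (r + 1) μ) :
    (T.datum (r + 1)).actF F μ (T.gzIdempotent F t) v =
      (T.datum (r + 1)).actF F μ (T.inclF F r (T.gzIdempotent F t.trunc)) v := by
  rw [gzIdempotent, CellDatum.actF_mul, t.vertex_last, T.actF_centralIdempotent_self]

/-- By compatibility of the branching factors, `m_ν d_t` lies in the left ideal of `A_r` generated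
by `m_{t(j)} d_{t(0) → ⋯ → t(j)}`, for every `j ≤ r`. As the latter lies in the ideal
`A_j^{⊵ t(j)}`, it is killed by the block idempotent of `s(j)` unless `s(j) ⊵ t(j)`. -/
theorem tmul_m_mul_gzIdempotent_eq_zero [Subsingleton (L 0)] (hC : C.IsDiagramTower F) {r : ℕ}
    {μ ν : L r} (s : T.Std r μ) (t : T.Std r ν)
    (h : ∃ j hj, ¬ s.vertex j hj ≥ t.vertex j hj) :
    ((1 : F) ⊗ₜ[R] ((C.m r ν : A r) * C.pathFactor t)) * T.gzIdempotent F s = 0 := by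
  induction r with
  | zero =>
    obtain ⟨j, hj, h⟩ := h
    obtain rfl := Nat.le_zero.mp hj
    exact absurd (Subsingleton.elim _ _).ge h
  | succ r ih =>
    rw [gzIdempotent]
    by_cases hl : s.vertex (r + 1) le_rfl ≥ t.vertex (r + 1) le_rfl
    · obtain ⟨j, hj, h⟩ := h
      rcases Nat.of_le_succ hj with hj' | rfl
      · have h1 := ih s.trunc t.trunc ⟨j, hj', h⟩
        obtain ⟨u, hu⟩ := hC.compatible r _ _ (t.edge r le_rfl)
        rw [t.vertex_last] at hu
        have h2 : (C.m (r + 1) ν : A (r + 1)) * C.pathFactor t =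
            (T.datum (r + 1)).inv u *
              T.incl r ((C.m r (t.vertex r (Nat.le_succ r)) : A r) * C.pathFactor t.trunc) := by
          rw [pathFactor, t.vertex_last, ← mul_assoc, hu, map_mul, mul_assoc]
        rw [h2, ← mul_one (1 : F), ← Algebra.TensorProduct.tmul_mul_tmul,
          ← inclF_tmul, mul_assoc, ← mul_assoc (T.inclF F r _), ← map_mul, h1, map_zero, zero_mul,
          mul_zero]
      · exact absurd hl h
    · rw [T.mul_centralIdempotent_comm, ← mul_assoc,
        T.tmul_mul_centralIdempotent_eq_zero F (r + 1) hl, zero_mul]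
      rw [t.vertex_last]
      exact (T.datum (r + 1)).idealGE_mul_right ν (C.m (r + 1) ν).2 _

theorem actF_gzIdempotent_seminormal_self {r : ℕ} {μ : L r} (t : T.Std r μ) :
    (T.datum r).actF F μ (T.gzIdempotent F t) (C.seminormal F t) = C.seminormal F t := by
  rw [seminormal, ← CellDatum.actF_mul, gzIdempotent_mul_self]

theorem actF_gzIdempotent_seminormal_of_ne (hC : C.IsDiagramTower F) {r : ℕ} {μ : L r}
    {s t : T.Std r μ} (h : s ≠ t) :
    (T.datum r).actF F μ (T.gzIdempotent F s) (C.seminormal F t) = 0 := by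
  have := hC.subsingleton_label_zero
  rw [seminormal, ← CellDatum.actF_mul, gzIdempotent_mul_of_ne, map_zero, LinearMap.zero_apply]
  by_contra! h'
  refine h ?_
  ext j hj
  exact (h' j hj).symm

variable [IsFractionRing R F]

/-- For an edge `ν → μ`, the block of `ν` in `Δ^F(μ)` is a copy of `Δ^F(ν)`, in which the generator
of `Δ^F(ν)` is the component of `δ(μ) d_{ν → μ}`. -/
theorem exists_branching_embedding {r : ℕ} {ν : L r} {μ : L (r + 1)} (h : T.Edge r ν μ) :
    ∃ ψ : F ⊗[R] T.Cell r ν →ₗ[F] F ⊗[R] T.Cell (r + 1) μ,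
      Function.Injective ψ ∧
      (∀ a w, ψ ((T.datum r).actF F ν a w) =
        (T.datum (r + 1)).actF F μ (T.inclF F r a) (ψ w)) ∧
      (∀ v, ∃ w, ψ w = (T.datum (r + 1)).actF F μ
        (T.inclF F r (T.centralIdempotent F r ν)) v) ∧
      ψ (1 ⊗ₜ C.gen r ν) =
        (T.datum (r + 1)).actF F μ (T.inclF F r (T.centralIdempotent F r ν))
          (1 ⊗ₜ (T.datum (r + 1)).act μ (C.d r ν μ) (C.gen (r + 1) μ)) := by
  obtain ⟨i, rfl⟩ := C.exists_label_eq F h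
  obtain ⟨ψ, hinj, hact, hsurj, hgen⟩ := (C.filtration r μ).exists_embedding F i
  obtain ⟨hmem, hd⟩ := C.d_spec r μ i
  refine ⟨ψ, hinj, hact, hsurj, ?_⟩
  rw [← hd]
  exact hgen _ hmem

/-- The vectors of `Δ^F(μ)` are detected by the Gelfand–Zeitlin idempotents of the paths to `μ`. -/
theorem eq_zero_of_forall_actF_gzIdempotent (C : T.MurphyData) [Subsingleton (L 0)] {r : ℕ}
    {μ : L r}
    {v : F ⊗[R] T.Cell r μ}
    (h : ∀ s : T.Std r μ, (T.datum r).actF F μ (T.gzIdempotent F s) v = 0) : v = 0 := by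
  induction r with
  | zero =>
    have h1 := h ⟨fun j hj => Nat.le_zero.mp hj ▸ μ, fun j hj => by omega, rfl⟩
    rwa [gzIdempotent, CellDatum.actF_one] at h1
  | succ r ih =>
    have := Fintype.ofFinite (L r)
    have hv : ∑ ν, (T.datum (r + 1)).actF F μ
        (T.inclF F r (T.centralIdempotent F r ν)) v = v := by
      rw [← LinearMap.sum_apply, ← map_sum, ← map_sum, T.sum_centralIdempotent, map_one,
        CellDatum.actF_one]
    rw [← hv]
    refine Finset.sum_eq_zero fun ν _ => ?_
    by_cases hν : T.Edge r ν μ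
    · obtain ⟨ψ, hinj, hact, hsurj, -⟩ := C.exists_branching_embedding F hν
      obtain ⟨w, hw⟩ := hsurj v
      rw [← hw, ih (v := w), map_zero]
      intro s
      obtain ⟨t, ht⟩ := s.exists_snoc hν
      refine hinj ?_
      rw [map_zero, hact, hw, ← actF_inclF_gzIdempotent, ← h t, actF_gzIdempotent_succ]
      congr 3
      exact gzIdempotent_congr F fun j hj => (ht j hj).symm
    · exact (C.filtration r μ).actF_centralIdempotent_eq_zero F
        (fun i hi => hν ⟨C.filtration r μ, i, hi⟩) v

end

section

variable [IsDomain R] [IsFractionRing R F] [∀ r, Finite (L r)] [∀ r μ, Nonempty (I r μ)]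
  [∀ r, IsSemisimpleRing (F ⊗[R] A r)]

/-- The image of `F_t` on `Δ^F(μ)` is the line spanned by the seminormal vector `f_t`. -/
theorem seminormal_ne_zero_and_actF_gzIdempotent_mem (hC : C.IsDiagramTower F) {r : ℕ} {μ : L r}
    (t : T.Std r μ) :
    C.seminormal F t ≠ 0 ∧
      ∀ v, ∃ c : F, (T.datum r).actF F μ (T.gzIdempotent F t) v = c • C.seminormal F t := by
  have := hC.subsingleton_label_zero
  induction r with
  | zero =>
    have h1 : C.seminormal F t = 1 ⊗ₜ C.gen 0 μ := by
      rw [seminormal, murphyF, murphy, gzIdempotent, pathFactor, CellDatum.act_one,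
        CellDatum.actF_one]
    have h2 : (1 : F) ⊗ₜ[R] C.gen 0 μ ≠ 0 :=
      fun h => C.gen_ne_zero 0 μ (eq_zero_of_one_tmul_eq_zero F h)
    refine ⟨h1 ▸ h2, fun v => ?_⟩
    obtain ⟨c, hc⟩ := (finrank_eq_one_iff_of_nonzero' _ h2).mp (hC.finrank_cell_zero μ) v
    exact ⟨c, by rw [gzIdempotent, CellDatum.actF_one, h1, hc]⟩
  | succ r ih =>
    have hedge := t.edge r le_rfl
    rw [t.vertex_last] at hedge
    obtain ⟨ψ, hinj, hact, hsurj, hgen⟩ := C.exists_branching_embedding F hedge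
    obtain ⟨ih1, ih2⟩ := ih t.trunc
    -- the embedding of `Δ^F(t(r))` sends the seminormal vector of the truncated path to `f_t`
    have h1 : C.seminormal F t = ψ (C.seminormal F t.trunc) := by
      have h2 : C.murphyF F t.trunc = (T.datum r).actF F _ (1 ⊗ₜ C.pathFactor t.trunc)
          (1 ⊗ₜ C.gen r (t.vertex r (Nat.le_succ r))) := by
        rw [CellDatum.actF_tmul, one_mul]
        rfl
      have h3 : C.murphyF F t = (T.datum (r + 1)).actF F μ
          (T.inclF F r (1 ⊗ₜ C.pathFactor t.trunc)) (1 ⊗ₜ (T.datum (r + 1)).act μ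
            (C.d r (t.vertex r (Nat.le_succ r)) μ) (C.gen (r + 1) μ)) := by
        rw [inclF_tmul, CellDatum.actF_tmul, one_mul, ← CellDatum.act_mul, murphyF, murphy,
          pathFactor, t.vertex_last]
      rw [seminormal, seminormal, hact, h2, hact, hgen, actF_gzIdempotent_succ,
        actF_inclF_gzIdempotent, h3]
      simp only [← CellDatum.actF_mul, ← map_mul]
      rw [T.mul_centralIdempotent_comm]
    refine ⟨?_, fun v => ?_⟩
    · rw [h1]
      exact (map_ne_zero_iff ψ hinj).mpr ih1
    · obtain ⟨w, hw⟩ := hsurj v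
      obtain ⟨c, hc⟩ := ih2 w
      refine ⟨c, ?_⟩
      rw [actF_gzIdempotent_succ, actF_inclF_gzIdempotent, ← hw, ← hact, hc, map_smul, h1]

/-- `m_t F_s = 0` unless `s ⊵ t`. -/
theorem actF_gzIdempotent_murphyF_eq_zero (hC : C.IsDiagramTower F) {r : ℕ} {μ : L r}
    {s t : T.Std r μ} (h : ¬ s.Dominates t) :
    (T.datum r).actF F μ (T.gzIdempotent F s) (C.murphyF F t) = 0 := by
  have := hC.subsingleton_label_zero
  have h1 : ∃ j hj, ¬ s.vertex j hj ≥ t.vertex j hj := by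
    simpa only [Std.Dominates, not_forall] using h
  have h2 : C.murphyF F t =
      (T.datum r).actF F μ (1 ⊗ₜ C.pathFactor t) (1 ⊗ₜ C.gen r μ) := by
    rw [CellDatum.actF_tmul, one_mul]
    rfl
  rw [h2, ← CellDatum.actF_mul]
  apply C.actF_gen_eq_zero F r μ
  rw [← mul_assoc, Algebra.TensorProduct.tmul_mul_tmul, mul_one]
  exact C.tmul_m_mul_gzIdempotent_eq_zero F hC s t h1

theorem sum_actF_gzIdempotent (hC : C.IsDiagramTower F) {r : ℕ} {μ : L r}
    (v : F ⊗[R] T.Cell r μ) :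
    ∑ s : T.Std r μ, (T.datum r).actF F μ (T.gzIdempotent F s) v = v := by
  have := hC.subsingleton_label_zero
  rw [eq_comm, ← sub_eq_zero]
  refine eq_zero_of_forall_actF_gzIdempotent F C fun s => ?_
  rw [map_sub, map_sum, Finset.sum_eq_single s, ← CellDatum.actF_mul, gzIdempotent_mul_self,
    sub_self]
  · intro t _ hts
    obtain ⟨c, hc⟩ := (C.seminormal_ne_zero_and_actF_gzIdempotent_mem F hC t).2 v
    rw [hc, map_smul, C.actF_gzIdempotent_seminormal_of_ne F hC hts.symm, smul_zero]
  · simp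

/-- Dominance triangularity of the Murphy basis: expand `m_t = ∑ s, m_t F_s`. -/
theorem murphyF_eq_seminormal_add (hC : C.IsDiagramTower F) {r : ℕ} {μ : L r} (t : T.Std r μ) :
    ∃ c : T.Std r μ → F, C.murphyF F t = C.seminormal F t +
      ∑ s with s.StrictlyDominates t, c s • C.seminormal F s := by
  classical
  choose c hc using fun s : T.Std r μ =>
    (C.seminormal_ne_zero_and_actF_gzIdempotent_mem F hC s).2 (C.murphyF F t)
  refine ⟨c, ?_⟩
  conv_lhs => rw [← C.sum_actF_gzIdempotent F hC (C.murphyF F t)]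
  rw [← Finset.add_sum_erase _ _ (Finset.mem_univ t)]
  congr 1
  rw [← Finset.sum_congr rfl fun s _ => hc s]
  refine (Finset.sum_subset ?_ ?_).symm
  · intro s hs
    exact Finset.mem_erase.mpr ⟨(Finset.mem_filter.mp hs).2.1, Finset.mem_univ s⟩
  · intro s hs hs'
    refine C.actF_gzIdempotent_murphyF_eq_zero F hC fun hdom => hs' ?_
    exact Finset.mem_filter.mpr ⟨Finset.mem_univ s, Finset.ne_of_mem_erase hs, hdom⟩

theorem exists_seminormal_basis (hC : C.IsDiagramTower F) (r : ℕ) (μ : L r) :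
    ∃ b : Module.Basis (T.Std r μ) F (F ⊗[R] T.Cell r μ), ∀ t, b t = C.seminormal F t := by
  classical
  have hli : LinearIndependent F fun t : T.Std r μ => C.seminormal F t := by
    rw [Fintype.linearIndependent_iff]
    intro g hg t
    have h1 : (T.datum r).actF F μ (T.gzIdempotent F t)
        (∑ s : T.Std r μ, g s • C.seminormal F s) = 0 := by rw [hg, map_zero]
    rw [map_sum, Finset.sum_eq_single t, map_smul, C.actF_gzIdempotent_seminormal_self F] at h1
    · exact (smul_eq_zero.mp h1).resolve_right
        (C.seminormal_ne_zero_and_actF_gzIdempotent_mem F hC t).1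
    · intro s _ hs
      rw [map_smul, C.actF_gzIdempotent_seminormal_of_ne F hC hs.symm, smul_zero]
    · simp
  have hsp : ⊤ ≤ Submodule.span F (Set.range fun t : T.Std r μ => C.seminormal F t) := by
    intro v _
    rw [← C.sum_actF_gzIdempotent F hC v]
    refine Submodule.sum_mem _ fun s _ => ?_
    obtain ⟨c, hc⟩ := (C.seminormal_ne_zero_and_actF_gzIdempotent_mem F hC s).2 v
    rw [hc]
    exact Submodule.smul_mem _ _ (Submodule.subset_span ⟨s, rfl⟩)
  exact ⟨Module.Basis.mk hli hsp, fun t => by rw [Module.Basis.mk_apply]⟩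

end

end MurphyData

/-! ### Inversion of a unitriangular system -/

theorem Std.Dominates.trans {r : ℕ} {μ : L r} {s t u : T.Std r μ} (h : s.Dominates t)
    (h' : t.Dominates u) : s.Dominates u := fun j hj => (h' j hj).trans (h j hj)

theorem Std.StrictlyDominates.trans {r : ℕ} {μ : L r} {s t u : T.Std r μ}
    (h : s.StrictlyDominates t) (h' : t.StrictlyDominates u) : s.StrictlyDominates u := by
  refine ⟨?_, h.2.trans h'.2⟩
  rintro rfl
  refine h.1 ?_
  ext j hj
  exact le_antisymm (h'.2 j hj) (h.2 j hj)

/-- The inverse of a unitriangular transition matrix is unitriangular. -/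
theorem Std.exists_eq_add_sum_strictlyDominates [∀ r, Finite (L r)] {K V : Type*} [Field K]
    [AddCommGroup V] [Module K V] {r : ℕ} {μ : L r} (f m : T.Std r μ → V)
    (h : ∀ t, ∃ c : T.Std r μ → K, m t = f t + ∑ s with s.StrictlyDominates t, c s • f s)
    (t : T.Std r μ) :
    ∃ c : T.Std r μ → K, f t = m t + ∑ s with s.StrictlyDominates t, c s • m s := by
  classical
  have hwf : WellFounded fun s t : T.Std r μ => s.StrictlyDominates t :=
    haveI : IsTrans (T.Std r μ) fun s t => s.StrictlyDominates t := ⟨fun _ _ _ h h' => h.trans h'⟩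
    haveI : Std.Irrefl fun s t : T.Std r μ => s.StrictlyDominates t := ⟨fun _ h => h.1 rfl⟩
    Finite.wellFounded_of_trans_of_irrefl _
  induction t using hwf.induction with
  | h t ih =>
    -- the span of the `m s` with `s ▷ t` contains every `f s` with `s ▷ t`
    let W : Submodule K V := Submodule.span K (m '' {s | s.StrictlyDominates t})
    have hW : ∀ s, s.StrictlyDominates t → f s ∈ W := by
      intro s hs
      obtain ⟨c, hc⟩ := ih s hs
      rw [hc]
      refine Submodule.add_mem _ (Submodule.subset_span ⟨s, hs, rfl⟩)
        (Submodule.sum_mem _ fun u hu => Submodule.smul_mem _ _ (Submodule.subset_span ⟨u, ?_, rfl⟩))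
      exact (Finset.mem_filter.mp hu).2.trans hs
    obtain ⟨c, hc⟩ := h t
    have h1 : f t - m t ∈ W := by
      rw [hc, sub_add_cancel_left]
      exact Submodule.neg_mem _ (Submodule.sum_mem _ fun s hs =>
        Submodule.smul_mem _ _ (hW s (Finset.mem_filter.mp hs).2))
    have h2 : {s | s.StrictlyDominates t} =
        ((Finset.univ.filter fun s => s.StrictlyDominates t : Finset (T.Std r μ)) :
          Set (T.Std r μ)) := by
      simp
    simp only [W] at h1
    rw [h2, Submodule.mem_span_image_finset_iff_exists_fun'] at h1
    obtain ⟨c', hc'⟩ := h1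
    exact ⟨c', by rw [hc', add_sub_cancel]⟩

end

end CellularTower

theorem mainTheorem1 {R F : Type*} [CommRing R] [IsDomain R] [Field F] [Algebra R F]
    [IsFractionRing R F] {A : ℕ → Type*} [∀ r, Ring (A r)] [∀ r, Algebra R (A r)]
    {L : ℕ → Type*} [∀ r, PartialOrder (L r)] [∀ r, Finite (L r)]
    {I : ∀ r, L r → Type*} [∀ r μ, Fintype (I r μ)] [∀ r μ, Nonempty (I r μ)]
    (T : CellularTower R A L I) (C : T.MurphyData) (hC : C.IsDiagramTower F)
    (r : ℕ) (μ : L r) :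
    (∀ t : T.Std r μ,
      (∃ c : T.Std r μ → F,
        C.murphyF F t = C.seminormal F t +
          ∑ s with s.StrictlyDominates t, c s • C.seminormal F s) ∧
      (∃ c' : T.Std r μ → F,
        C.seminormal F t = C.murphyF F t +
          ∑ s with s.StrictlyDominates t, c' s • C.murphyF F s)) ∧
    ∃ b : Module.Basis (T.Std r μ) F (F ⊗[R] T.Cell r μ), ∀ t, b t = C.seminormal F t := by
  have : ∀ r, IsSemisimpleRing (F ⊗[R] A r) := fun r => (hC.split_semisimple r).isSemisimpleRing
  exact ⟨fun t => ⟨C.murphyF_eq_seminormal_add F hC t,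
    CellularTower.Std.exists_eq_add_sum_strictlyDominates _ _
      (C.murphyF_eq_seminormal_add F hC) t⟩, C.exists_seminormal_basis F hC r μ⟩
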